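/- An $n$-counter Minsky machine $M$ ($n\ge 0$) is a finite list $I_1;\dots;I_s$ of instructions, each of one of the forms (1) $L_i:\ x_m:=x_m+1;\ \mathbf{goto}\ L_j$, (2) $L_i:\ x_m:=x_m-1;\ \mathbf{goto}\ L_j$, (3) $L_i:\ \mathbf{if}\ (x_m>0)\ \mathbf{then\ goto}\ L_j$, (4) $L_i:\ \mathbf{if}\ (x_m=0)\ \mathbf{then\ goto}\ L_j$, (5) $L_0:\ \mathbf{halt}$, where $1\le m\le n$, $i\ge 1$, $j\ge 0$. Several instructions may carry the same label, so $M$ may be non-deterministic. A configuration is a tuple $(L,c_1,\dots,c_n)$ consisting of a label and $n$ non-negative integers. A move applies an instruction of $M$ carrying the current label; (2) and (3) are applicable only if $x_m>0$, and (4) only if $x_m=0$. "$M$ can go from $K$ to $K'$" means that a finite sequence of moves leads from $K$ to $K'$. Take pairwise distinct positive literals $r_m,\kappa_m$ ($1\le m\le n$) and $l_i$ ($i\ge 0$). Axiomatize the instructions (1)–(4) by $$\varphi_{(1)}=l_i\multimap(l_j\otimes r_m),\qquad \varphi_{(2)}=(l_i\otimes r_m)\multimap l_j,$$ $$\varphi_{(3)}=(l_i\otimes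 r_m)\multimap(l_j\otimes r_m),\qquad \varphi_{(4)}=l_i\multimap(l_j\oplus\kappa_m).$$ Let $\Phi_M$ be the multiset of the formulas $\varphi_I$ for the instructions $I$ of $M$ of types (1)–(4). Let $\mathcal K$ be the multiset consisting, for every $m=1,\dots,n$, of $\kappa_m\multimap l_0$ and of the $n-1$ implications $(\kappa_m\otimes r_i)\multimap\kappa_m$, $i\ne m$. **Theorem 5.** For every $n$, every $n$-counter Minsky machine $M$ and all non-negative integers $k_1,\dots,k_n$, the machine $M$ can go from the initial configuration $(L_1,k_1,\dots,k_n)$ to the halting configuration $(L_0,0,\dots,0)$ if and only if the sequent $$l_1\otimes r_1^{k_1}\otimes\cdots\otimes r_n^{k_n},\ !\Phi_M,\ !\mathcal K\ \vdash\ l_0$$ is derivable in (full, classical, propositional) linear logic; here $r^{k}$ stands for $k$ tensor factors $r$, and $!\Phi_M$, $!\mathcal K$ for the multisets of the formulas $!A$ with $A$ in $\Phi_M$, respectively in $\mathcal K$. Moreover, full propositional linear logic (over countably many literals) is undecidable: there is no algorithm which, given a sequent $\Gamma\vdash\Delta$ of formulas built with all the connectives and exponentials, decides whether $\Gamma\vdash\Delta$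 is derivable. -/

import Mathlib

/-! ### Propositional linear logic -/

/-- Formulas of full (classical) propositional linear logic over a type `α` of positive literals. -/
inductive LLFormula (α : Type) : Type
  | atom : α → LLFormula α
  | neg : LLFormula α → LLFormula α
  | one : LLFormula α
  | bot : LLFormula α
  | top : LLFormula α
  | zero : LLFormula α
  | tensor : LLFormula α → LLFormula α → LLFormula α
  | par : LLFormula α → LLFormula α → LLFormula α
  | lolli : LLFormula α → LLFormula α → LLFormula α
  | amp : LLFormula α → LLFormula α → LLFormula α
  | plus : LLFormula α → LLFormula α → LLFormula α
  | bang : LLFormula α → LLFormula α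
  | whynot : LLFormula α → LLFormula α

open LLFormula in
/-- `LLDerivable Γ Δ`: the two-sided sequent `Γ ⊢ Δ` is derivable in classical propositional linear
logic. Sequents are pairs of finite multisets of formulas, so that exchange is built in. -/
inductive LLDerivable {α : Type} : Multiset (LLFormula α) → Multiset (LLFormula α) → Prop
  | ax (A : LLFormula α) : LLDerivable {A} {A}
  | cut (Γ Γ' Δ Δ' : Multiset (LLFormula α)) (A : LLFormula α) :
      LLDerivable Γ (A ::ₘ Δ) → LLDerivable (A ::ₘ Γ') Δ' → LLDerivable (Γ + Γ') (Δ + Δ')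
  | negL (Γ Δ : Multiset (LLFormula α)) (A : LLFormula α) :
      LLDerivable Γ (A ::ₘ Δ) → LLDerivable (neg A ::ₘ Γ) Δ
  | negR (Γ Δ : Multiset (LLFormula α)) (A : LLFormula α) :
      LLDerivable (A ::ₘ Γ) Δ → LLDerivable Γ (neg A ::ₘ Δ)
  | oneL (Γ Δ : Multiset (LLFormula α)) :
      LLDerivable Γ Δ → LLDerivable (one ::ₘ Γ) Δ
  | oneR : LLDerivable 0 {one}
  | botL : LLDerivable {bot} 0
  | botR (Γ Δ : Multiset (LLFormula α)) :
      LLDerivable Γ Δ → LLDerivable Γ (bot ::ₘ Δ)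
  | topR (Γ Δ : Multiset (LLFormula α)) : LLDerivable Γ (top ::ₘ Δ)
  | zeroL (Γ Δ : Multiset (LLFormula α)) : LLDerivable (zero ::ₘ Γ) Δ
  | tensorL (Γ Δ : Multiset (LLFormula α)) (A B : LLFormula α) :
      LLDerivable (A ::ₘ B ::ₘ Γ) Δ → LLDerivable (tensor A B ::ₘ Γ) Δ
  | tensorR (Γ Γ' Δ Δ' : Multiset (LLFormula α)) (A B : LLFormula α) :
      LLDerivable Γ (A ::ₘ Δ) → LLDerivable Γ' (B ::ₘ Δ') →
      LLDerivable (Γ + Γ') (tensor A B ::ₘ (Δ + Δ'))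
  | parL (Γ Γ' Δ Δ' : Multiset (LLFormula α)) (A B : LLFormula α) :
      LLDerivable (A ::ₘ Γ) Δ → LLDerivable (B ::ₘ Γ') Δ' →
      LLDerivable (par A B ::ₘ (Γ + Γ')) (Δ + Δ')
  | parR (Γ Δ : Multiset (LLFormula α)) (A B : LLFormula α) :
      LLDerivable Γ (A ::ₘ B ::ₘ Δ) → LLDerivable Γ (par A B ::ₘ Δ)
  | lolliL (Γ Γ' Δ Δ' : Multiset (LLFormula α)) (A B : LLFormula α) :
      LLDerivable Γ (A ::ₘ Δ) → LLDerivable (B ::ₘ Γ') Δ' →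
      LLDerivable (lolli A B ::ₘ (Γ + Γ')) (Δ + Δ')
  | lolliR (Γ Δ : Multiset (LLFormula α)) (A B : LLFormula α) :
      LLDerivable (A ::ₘ Γ) (B ::ₘ Δ) → LLDerivable Γ (lolli A B ::ₘ Δ)
  | ampL₁ (Γ Δ : Multiset (LLFormula α)) (A B : LLFormula α) :
      LLDerivable (A ::ₘ Γ) Δ → LLDerivable (amp A B ::ₘ Γ) Δ
  | ampL₂ (Γ Δ : Multiset (LLFormula α)) (A B : LLFormula α) :
      LLDerivable (B ::ₘ Γ) Δ → LLDerivable (amp A B ::ₘ Γ) Δ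
  | ampR (Γ Δ : Multiset (LLFormula α)) (A B : LLFormula α) :
      LLDerivable Γ (A ::ₘ Δ) → LLDerivable Γ (B ::ₘ Δ) → LLDerivable Γ (amp A B ::ₘ Δ)
  | plusL (Γ Δ : Multiset (LLFormula α)) (A B : LLFormula α) :
      LLDerivable (A ::ₘ Γ) Δ → LLDerivable (B ::ₘ Γ) Δ → LLDerivable (plus A B ::ₘ Γ) Δ
  | plusR₁ (Γ Δ : Multiset (LLFormula α)) (A B : LLFormula α) :
      LLDerivable Γ (A ::ₘ Δ) → LLDerivable Γ (plus A B ::ₘ Δ)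
  | plusR₂ (Γ Δ : Multiset (LLFormula α)) (A B : LLFormula α) :
      LLDerivable Γ (B ::ₘ Δ) → LLDerivable Γ (plus A B ::ₘ Δ)
  | bangL (Γ Δ : Multiset (LLFormula α)) (A : LLFormula α) :
      LLDerivable (A ::ₘ Γ) Δ → LLDerivable (bang A ::ₘ Γ) Δ
  | bangW (Γ Δ : Multiset (LLFormula α)) (A : LLFormula α) :
      LLDerivable Γ Δ → LLDerivable (bang A ::ₘ Γ) Δ
  | bangC (Γ Δ : Multiset (LLFormula α)) (A : LLFormula α) :
      LLDerivable (bang A ::ₘ bang A ::ₘ Γ) Δ → LLDerivable (bang A ::ₘ Γ) Δ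
  | bangR (Γ Δ : Multiset (LLFormula α)) (A : LLFormula α) :
      LLDerivable (Γ.map bang) (A ::ₘ Δ.map whynot) →
      LLDerivable (Γ.map bang) (bang A ::ₘ Δ.map whynot)
  | whynotL (Γ Δ : Multiset (LLFormula α)) (A : LLFormula α) :
      LLDerivable (A ::ₘ Γ.map bang) (Δ.map whynot) →
      LLDerivable (whynot A ::ₘ Γ.map bang) (Δ.map whynot)
  | whynotR (Γ Δ : Multiset (LLFormula α)) (A : LLFormula α) :
      LLDerivable Γ (A ::ₘ Δ) → LLDerivable Γ (whynot A ::ₘ Δ)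
  | whynotW (Γ Δ : Multiset (LLFormula α)) (A : LLFormula α) :
      LLDerivable Γ Δ → LLDerivable Γ (whynot A ::ₘ Δ)
  | whynotC (Γ Δ : Multiset (LLFormula α)) (A : LLFormula α) :
      LLDerivable Γ (whynot A ::ₘ whynot A ::ₘ Δ) → LLDerivable Γ (whynot A ::ₘ Δ)

/-! ### Decidability of linear logic -/

/-- The Gödel number of a formula over the countable set `ℕ` of propositional letters. -/
def LLFormula.code : LLFormula ℕ → ℕ
  | .atom a => Nat.pair 0 a
  | .neg A => Nat.pair 1 A.code
  | .one => Nat.pair 2 0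
  | .bot => Nat.pair 3 0
  | .top => Nat.pair 4 0
  | .zero => Nat.pair 5 0
  | .tensor A B => Nat.pair 6 (Nat.pair A.code B.code)
  | .par A B => Nat.pair 7 (Nat.pair A.code B.code)
  | .lolli A B => Nat.pair 8 (Nat.pair A.code B.code)
  | .amp A B => Nat.pair 9 (Nat.pair A.code B.code)
  | .plus A B => Nat.pair 10 (Nat.pair A.code B.code)
  | .bang A => Nat.pair 11 A.code
  | .whynot A => Nat.pair 12 A.code

/-- Distinct formulas have distinct Gödel numbers. -/
theorem LLFormula.code_injective : Function.Injective LLFormula.code := by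
  intro A
  induction A with
  | atom a => intro B h; cases B <;> simp_all [LLFormula.code, Nat.pair_eq_pair]
  | one => intro B h; cases B <;> simp_all [LLFormula.code, Nat.pair_eq_pair]
  | bot => intro B h; cases B <;> simp_all [LLFormula.code, Nat.pair_eq_pair]
  | top => intro B h; cases B <;> simp_all [LLFormula.code, Nat.pair_eq_pair]
  | zero => intro B h; cases B <;> simp_all [LLFormula.code, Nat.pair_eq_pair]
  | neg A ih | bang A ih | whynot A ih =>
    intro B h
    cases B <;> simp [LLFormula.code, Nat.pair_eq_pair] at h
    rw [ih h]
  | tensor A A' ih ih' | par A A' ih ih' | lolli A A' ih ih' | amp A A' ih ih'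
  | plus A A' ih ih' =>
    intro B h
    cases B <;> simp [LLFormula.code, Nat.pair_eq_pair] at h
    rw [ih h.1, ih' h.2]

/-- Derivability in full propositional linear logic is (algorithmically) decidable: some computable
function, given the lists of Gödel numbers of the two sides of a sequent, tells whether the sequent
is derivable. Nothing is required of it on inputs that do not code a sequent. -/
def LLDecidable : Prop :=
  ∃ f : List ℕ × List ℕ → Bool, Computable f ∧
    ∀ Γ Δ : List (LLFormula ℕ),
      f (Γ.map LLFormula.code, Δ.map LLFormula.code) = true ↔
        LLDerivable (Γ : Multiset (LLFormula ℕ)) (Δ : Multiset (LLFormula ℕ))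

/-! ### Minsky machines -/

/-- Instructions of a nondeterministic `n`-counter machine. The label `L_i` is the number `i`; only
`halt` carries the label `L_0`, every other instruction has a label `L_i` with `i ≥ 1`. -/
inductive MinskyInstr (n : ℕ) : Type
  /-- `L_i: x_m := x_m + 1; goto L_j` -/
  | inc (i : ℕ+) (m : Fin n) (j : ℕ) : MinskyInstr n
  /-- `L_i: x_m := x_m - 1; goto L_j` -/
  | dec (i : ℕ+) (m : Fin n) (j : ℕ) : MinskyInstr n
  /-- `L_i: if (x_m > 0) then goto L_j` -/
  | ifPos (i : ℕ+) (m : Fin n) (j : ℕ) : MinskyInstr n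
  /-- `L_i: if (x_m = 0) then goto L_j` -/
  | ifZero (i : ℕ+) (m : Fin n) (j : ℕ) : MinskyInstr n
  /-- `L_0: halt` -/
  | halt : MinskyInstr n

/-- A machine is given by its program, a finite list of instructions; several instructions may carry
the same label. -/
abbrev MinskyMachine (n : ℕ) : Type := List (MinskyInstr n)

/-- Configurations `(L, c_1, …, c_n)`. -/
structure MinskyConfig (n : ℕ) : Type where
  label : ℕ
  counter : Fin n → ℕ

/-- `I.Step K K'`: the instruction `I` can be applied in `K` and leads to `K'`. Counters hold
non-negative integers, so a decrement applies only to a positive counter. -/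
inductive MinskyInstr.Step {n : ℕ} : MinskyInstr n → MinskyConfig n → MinskyConfig n → Prop
  | inc (i : ℕ+) (m : Fin n) (j : ℕ) (c : Fin n → ℕ) :
      MinskyInstr.Step (.inc i m j) ⟨i, c⟩ ⟨j, Function.update c m (c m + 1)⟩
  | dec (i : ℕ+) (m : Fin n) (j : ℕ) (c : Fin n → ℕ) (h : 0 < c m) :
      MinskyInstr.Step (.dec i m j) ⟨i, c⟩ ⟨j, Function.update c m (c m - 1)⟩
  | ifPos (i : ℕ+) (m : Fin n) (j : ℕ) (c : Fin n → ℕ) (h : 0 < c m) :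
      MinskyInstr.Step (.ifPos i m j) ⟨i, c⟩ ⟨j, c⟩
  | ifZero (i : ℕ+) (m : Fin n) (j : ℕ) (c : Fin n → ℕ) (h : c m = 0) :
      MinskyInstr.Step (.ifZero i m j) ⟨i, c⟩ ⟨j, c⟩

/-- One move of the machine `M`. -/
def MinskyMachine.Move {n : ℕ} (M : MinskyMachine n) (K K' : MinskyConfig n) : Prop :=
  ∃ I ∈ M, I.Step K K'

/-- `M` can go from `K` to `K'` by a finite computation. -/
def MinskyMachine.CanGo {n : ℕ} (M : MinskyMachine n) : MinskyConfig n → MinskyConfig n → Prop :=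
  Relation.ReflTransGen M.Move

/-! ### The encoding -/

/-- The literals of the encoding: `r_m` for the counters, `l_i` for the labels, `κ_m` for killing. -/
inductive MinskyLit (n : ℕ) : Type
  | r (m : Fin n) : MinskyLit n
  | l (i : ℕ) : MinskyLit n
  | κ (m : Fin n) : MinskyLit n

namespace MinskyEnc

open LLFormula

variable {n : ℕ}

/-- The literal `r_m` as a formula. -/
def r (m : Fin n) : LLFormula (MinskyLit n) := atom (.r m)

/-- The literal `l_i` as a formula. -/
def l (i : ℕ) : LLFormula (MinskyLit n) := atom (.l i)

/-- The literal `κ_m` as a formula. -/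
def κ (m : Fin n) : LLFormula (MinskyLit n) := atom (.κ m)

/-- The list of the literals `r_1` (`k_1` times), …, `r_n` (`k_n` times). -/
def counters (k : Fin n → ℕ) : List (LLFormula (MinskyLit n)) :=
  (List.finRange n).flatMap fun m => List.replicate (k m) (r m)

/-- The simple product `l_i ⊗ r_1^{k_1} ⊗ ⋯ ⊗ r_n^{k_n}`, bracketed to the left. -/
def config (i : ℕ) (k : Fin n → ℕ) : LLFormula (MinskyLit n) :=
  (counters k).foldl tensor (l i)

/-- The formula `φ_I` of an instruction; the halting instruction has none. -/
def phi : MinskyInstr n → Option (LLFormula (MinskyLit n))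
  | .inc i m j => some (lolli (l i) (tensor (l j) (r m)))
  | .dec i m j => some (lolli (tensor (l i) (r m)) (l j))
  | .ifPos i m j => some (lolli (tensor (l i) (r m)) (tensor (l j) (r m)))
  | .ifZero i m j => some (lolli (l i) (plus (l j) (κ m)))
  | .halt => none

/-- The multiset `Φ_M`. -/
def Phi (M : MinskyMachine n) : Multiset (LLFormula (MinskyLit n)) := (M.filterMap phi : List _)

/-- The multiset `𝒦_m`: the implication `κ_m ⊸ l_0` and the `n - 1` killing implications
`κ_m ⊗ r_i ⊸ κ_m`, `i ≠ m`. -/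
def killing (m : Fin n) : Multiset (LLFormula (MinskyLit n)) :=
  lolli (κ m) (l 0) ::ₘ
    (Finset.univ.erase m).val.map fun i => lolli (tensor (κ m) (r i)) (κ m)

/-- The multiset `𝒦`, the union of the pairwise disjoint `𝒦_m`. -/
def allKilling (n : ℕ) : Multiset (LLFormula (MinskyLit n)) := ∑ m : Fin n, killing m

end MinskyEnc

/-! ### Phase semantics -/

/-! From computations to derivations: a configuration is one label literal together with counter
literals on the left of the sequent. Reading a computation backwards from `l 0`, each move costs one
left implication on a contracted axiom. A zero test leaves `l j ⊕ κ m` on the left, hence two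
branches: one continues the computation, while in the other `κ m` absorbs all `r i` with `i ≠ m` and
then turns into `l 0`. The second branch closes because no `r m` is present (`derivable_of_killing`,
`derivable_of_step`).

The converse avoids cut elimination. Phase semantics is sound for all rules, cut included (`sound`),
so one well-chosen phase space suffices. Its phases are pairs of a multiset of control tokens and a
tuple of counter values; its pole consists of the configurations that can reach the halting
configuration, and of the `κ m` states whose `m`-th counter is zero. The pole is closed under
backward moves, so every axiom under `!` contains the unit `0`, and validity of the sequent says
that the initial configuration is in the pole (`canGo_of_derivable`).

For undecidability, halting is written as `∃ v, p k v = 0` with `p` primitive recursive. A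
structured counter program computes `p` (`exists_realizes`) and is compiled to a machine that first
guesses `v`; thus no unbounded search needs compiling, and ending with all counters zero means `p k
v = 0`. The machine is fixed and only the number of factors `r 0` varies with the input, so the
reduction is computable on Gödel numbers. -/

namespace PhaseSemantics

open Pointwise

variable {M : Type} [AddCommMonoid M] {B X Y R R' : Set M}

/-- The orthogonal of a set `X` of phases with respect to the pole `B`. -/
def orth (B X : Set M) : Set M := {y | ∀ x ∈ X, x + y ∈ B}

theorem orth_anti (h : X ⊆ Y) : orth B Y ⊆ orth B X := fun _ hy x hx => hy x (h hx)

theorem subset_orth_iff : R ⊆ orth B X ↔ X + R ⊆ B := by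
  rw [Set.add_subset_iff]
  exact ⟨fun h x hx y hy => h hy x hx, fun h y hy x hx => h x hx y hy⟩

theorem subset_orth_orth : X ⊆ orth B (orth B X) := by
  rw [subset_orth_iff, add_comm, ← subset_orth_iff]

theorem orth_orth_orth (X : Set M) : orth B (orth B (orth B X)) = orth B X :=
  (orth_anti subset_orth_orth).antisymm subset_orth_orth

/-- Closure is invisible to the pole: a biorthogonal may be tested on its generators. Most cases of
soundness reduce to this. -/
theorem orth_orth_add (h : X + R ⊆ B) : orth B (orth B X) + R ⊆ B := by
  rw [← subset_orth_iff, orth_orth_orth, subset_orth_iff]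
  exact h

theorem orth_add_add (h : R ⊆ X) (h' : R' ⊆ Y) : orth B (X + Y) + (R + R') ⊆ B := by
  rw [add_comm, ← subset_orth_iff]
  exact orth_anti (Set.add_subset_add h h')

/-- Turns a formula on the right of a valid sequent into an inclusion of the remaining context in
its fact. -/
theorem subset_of_orth_add (hX : orth B (orth B X) = X) (h : orth B X + R ⊆ B) : R ⊆ X := by
  rw [← hX, subset_orth_iff]
  exact h

/-- The generators of an exponential lie in `{0}`, whose only element is idempotent; this makes
contraction sound. -/
theorem subset_add_self (h : X ⊆ 0) : X ⊆ X + X := by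
  intro x hx
  have h0 : x = 0 := h hx
  subst h0
  exact ⟨0, hx, 0, hx, add_zero 0⟩

open LLFormula in
/-- The interpretation of formulas as facts. The exponential `!A` is interpreted with the trivial
submonoid `{0}`. -/
def interp {α : Type} (B : Set M) (v : α → M) : LLFormula α → Set M
  | atom a => orth B (orth B {v a})
  | neg A => orth B (interp B v A)
  | one => orth B (orth B 0)
  | bot => orth B 0
  | top => orth B ∅
  | zero => orth B (orth B ∅)
  | tensor C D => orth B (orth B (interp B v C + interp B v D))
  | par C D => orth B (orth B (interp B v C) + orth B (interp B v D))
  | lolli C D => orth B (interp B v C + orth B (interp B v D))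
  | amp C D => orth B (orth B (interp B v C) ∪ orth B (interp B v D))
  | plus C D => orth B (orth B (interp B v C ∪ interp B v D))
  | bang A => orth B (orth B (interp B v A ∩ 0))
  | whynot A => orth B (orth B (interp B v A) ∩ 0)

variable {α : Type} {v : α → M}

theorem orth_orth_interp (A : LLFormula α) :
    orth B (orth B (interp B v A)) = interp B v A := by
  cases A <;> simp only [interp, orth_orth_orth]

/-- Validity of a sequent in the phase space with pole `B`. -/
def Valid (B : Set M) (v : α → M) (Γ Δ : Multiset (LLFormula α)) : Prop :=
  (Γ.map (interp B v)).sum + (Δ.map fun A => orth B (interp B v A)).sum ⊆ B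

/-- A sum of interpretations of exponentials is generated by a subset of the unit. -/
theorem exists_sum_orth_orth {ι : Type} (s : Multiset ι) (f : ι → Set M) :
    ∃ S : Set M, S ⊆ 0 ∧ S ⊆ (s.map fun i => orth B (orth B (f i ∩ 0))).sum ∧
      ∀ R, S + R ⊆ B → (s.map fun i => orth B (orth B (f i ∩ 0))).sum + R ⊆ B := by
  induction s using Multiset.induction_on with
  | empty => exact ⟨0, subset_rfl, by simp, by simp⟩
  | cons i s ih =>
    obtain ⟨S, h0, hS, hR⟩ := ih
    refine ⟨(f i ∩ 0) + S, ?_, ?_, ?_⟩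
    · simpa using Set.add_subset_add (Set.inter_subset_right (s := f i)) h0
    · rw [Multiset.map_cons, Multiset.sum_cons]
      exact Set.add_subset_add subset_orth_orth hS
    · intro R h
      rw [Multiset.map_cons, Multiset.sum_cons, add_assoc]
      refine orth_orth_add ?_
      rw [add_left_comm]
      refine hR _ ?_
      rwa [add_left_comm, ← add_assoc]

/-- The promotion rule in a phase space. -/
theorem promotion {ι κ : Type} (s : Multiset ι) (t : Multiset κ) (f : ι → Set M) (g : κ → Set M)
    (h : (s.map fun i => orth B (orth B (f i ∩ 0))).sum +
      (t.map fun i => orth B (orth B (g i ∩ 0))).sum ⊆ X) :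
    orth B (X ∩ 0) + ((s.map fun i => orth B (orth B (f i ∩ 0))).sum +
      (t.map fun i => orth B (orth B (g i ∩ 0))).sum) ⊆ B := by
  -- Both contexts may be replaced by generating sets inside `{0}`. Their sum then lies in `X` and
  -- in `{0}`, that is, among the generators of the promoted formula.
  obtain ⟨S, hS0, hS, hSR⟩ := exists_sum_orth_orth (B := B) s f
  obtain ⟨T, hT0, hT, hTR⟩ := exists_sum_orth_orth (B := B) t g
  rw [add_left_comm]
  refine hSR _ ?_
  rw [← add_assoc, add_comm]
  refine hTR _ ?_
  rw [add_left_comm, ← add_assoc, ← subset_orth_iff]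
  refine orth_anti (Set.subset_inter ((Set.add_subset_add hS hT).trans h) ?_)
  simpa using Set.add_subset_add hS0 hT0

/-- Soundness of linear logic in phase spaces. -/
theorem sound {Γ Δ : Multiset (LLFormula α)} (h : LLDerivable Γ Δ) (B : Set M) (v : α → M) :
    Valid B v Γ Δ := by
  induction h with
  | ax A =>
    simp only [Valid, Multiset.map_singleton, Multiset.sum_singleton]
    rw [← subset_orth_iff]
  | cut Γ Γ' Δ Δ' A _ _ ih ih' =>
    simp only [Valid, Multiset.map_cons, Multiset.sum_cons, Multiset.map_add,
      Multiset.sum_add] at ih ih' ⊢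
    rw [add_left_comm] at ih
    -- The left premise places its whole context inside the fact of `A`, so that context can replace
    -- `A` in the right premise.
    have h := subset_of_orth_add (orth_orth_interp A) ih
    rw [add_assoc] at ih'
    rw [add_add_add_comm]
    exact (Set.add_subset_add_right h).trans ih'
  | negL Γ Δ A _ ih =>
    simp only [Valid, Multiset.map_cons, Multiset.sum_cons, interp] at ih ⊢
    rwa [add_assoc, add_left_comm]
  | negR Γ Δ A _ ih =>
    simp only [Valid, Multiset.map_cons, Multiset.sum_cons, interp, orth_orth_interp] at ih ⊢
    rwa [add_left_comm, ← add_assoc]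
  | oneL Γ Δ _ ih =>
    simp only [Valid, Multiset.map_cons, Multiset.sum_cons, interp] at ih ⊢
    rw [add_assoc]
    exact orth_orth_add (by simpa using ih)
  | oneR =>
    simp only [Valid, Multiset.map_zero, Multiset.sum_zero, Multiset.map_singleton,
      Multiset.sum_singleton, interp, orth_orth_orth]
    rw [← subset_orth_iff]
  | botL =>
    simp only [Valid, Multiset.map_zero, Multiset.sum_zero, Multiset.map_singleton,
      Multiset.sum_singleton, interp]
    rw [add_comm, ← subset_orth_iff]
  | botR Γ Δ _ ih =>
    simp only [Valid, Multiset.map_cons, Multiset.sum_cons, interp] at ih ⊢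
    rw [add_left_comm]
    exact orth_orth_add (by simpa using ih)
  | topR Γ Δ =>
    simp only [Valid, Multiset.map_cons, Multiset.sum_cons, interp]
    rw [add_left_comm]
    exact orth_orth_add (by simp)
  | zeroL Γ Δ =>
    simp only [Valid, Multiset.map_cons, Multiset.sum_cons, interp]
    rw [add_assoc]
    exact orth_orth_add (by simp)
  | tensorL Γ Δ C D _ ih =>
    simp only [Valid, Multiset.map_cons, Multiset.sum_cons, interp] at ih ⊢
    rw [add_assoc]
    exact orth_orth_add (by simpa only [add_assoc] using ih)
  | tensorR Γ Γ' Δ Δ' C D _ _ ih ih' =>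
    simp only [Valid, Multiset.map_cons, Multiset.sum_cons, Multiset.map_add,
      Multiset.sum_add, interp, orth_orth_orth] at ih ih' ⊢
    rw [add_left_comm] at ih ih' ⊢
    rw [add_add_add_comm]
    exact orth_add_add (subset_of_orth_add (orth_orth_interp C) ih)
      (subset_of_orth_add (orth_orth_interp D) ih')
  | parL Γ Γ' Δ Δ' C D _ _ ih ih' =>
    simp only [Valid, Multiset.map_cons, Multiset.sum_cons, Multiset.map_add,
      Multiset.sum_add, interp] at ih ih' ⊢
    rw [add_assoc] at ih ih' ⊢
    rw [add_add_add_comm]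
    exact orth_add_add (subset_orth_iff.2 ih) (subset_orth_iff.2 ih')
  | parR Γ Δ C D _ ih =>
    simp only [Valid, Multiset.map_cons, Multiset.sum_cons, interp] at ih ⊢
    rw [add_left_comm]
    exact orth_orth_add (by rwa [add_left_comm, add_assoc])
  | lolliL Γ Γ' Δ Δ' C D _ _ ih ih' =>
    simp only [Valid, Multiset.map_cons, Multiset.sum_cons, Multiset.map_add,
      Multiset.sum_add, interp] at ih ih' ⊢
    rw [add_left_comm] at ih
    rw [add_assoc] at ih' ⊢
    rw [add_add_add_comm]
    exact orth_add_add (subset_of_orth_add (orth_orth_interp C) ih) (subset_orth_iff.2 ih')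
  | lolliR Γ Δ C D _ ih =>
    simp only [Valid, Multiset.map_cons, Multiset.sum_cons, interp] at ih ⊢
    rw [add_left_comm]
    refine orth_orth_add ?_
    rwa [add_assoc, add_left_comm (orth B _), ← add_assoc]
  | ampL₁ Γ Δ C D _ ih =>
    simp only [Valid, Multiset.map_cons, Multiset.sum_cons, interp] at ih ⊢
    rw [add_assoc] at ih ⊢
    refine (Set.add_subset_add_right ?_).trans ih
    exact (orth_anti Set.subset_union_left).trans (orth_orth_interp C).subset
  | ampL₂ Γ Δ C D _ ih =>
    simp only [Valid, Multiset.map_cons, Multiset.sum_cons, interp] at ih ⊢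
    rw [add_assoc] at ih ⊢
    refine (Set.add_subset_add_right ?_).trans ih
    exact (orth_anti Set.subset_union_right).trans (orth_orth_interp D).subset
  | ampR Γ Δ C D _ _ ih ih' =>
    simp only [Valid, Multiset.map_cons, Multiset.sum_cons, interp] at ih ih' ⊢
    rw [add_left_comm] at ih ih' ⊢
    refine orth_orth_add ?_
    rw [Set.union_add]
    exact Set.union_subset ih ih'
  | plusL Γ Δ C D _ _ ih ih' =>
    simp only [Valid, Multiset.map_cons, Multiset.sum_cons, interp] at ih ih' ⊢
    rw [add_assoc] at ih ih' ⊢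
    refine orth_orth_add ?_
    rw [Set.union_add]
    exact Set.union_subset ih ih'
  | plusR₁ Γ Δ C D _ ih =>
    simp only [Valid, Multiset.map_cons, Multiset.sum_cons, interp, orth_orth_orth] at ih ⊢
    rw [add_left_comm] at ih ⊢
    exact (Set.add_subset_add_right (orth_anti Set.subset_union_left)).trans ih
  | plusR₂ Γ Δ C D _ ih =>
    simp only [Valid, Multiset.map_cons, Multiset.sum_cons, interp, orth_orth_orth] at ih ⊢
    rw [add_left_comm] at ih ⊢
    exact (Set.add_subset_add_right (orth_anti Set.subset_union_right)).trans ih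
  | bangL Γ Δ A _ ih =>
    simp only [Valid, Multiset.map_cons, Multiset.sum_cons, interp] at ih ⊢
    rw [add_assoc] at ih ⊢
    exact orth_orth_add ((Set.add_subset_add_right Set.inter_subset_left).trans ih)
  | bangW Γ Δ A _ ih =>
    simp only [Valid, Multiset.map_cons, Multiset.sum_cons, interp] at ih ⊢
    rw [add_assoc]
    exact orth_orth_add ((Set.add_subset_add_right Set.inter_subset_right).trans (by simpa using ih))
  | bangC Γ Δ A _ ih =>
    simp only [Valid, Multiset.map_cons, Multiset.sum_cons, interp] at ih ⊢
    rw [← add_assoc, add_assoc] at ih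
    rw [add_assoc]
    refine orth_orth_add ((Set.add_subset_add_right
      ((subset_add_self Set.inter_subset_right).trans ?_)).trans ih)
    exact Set.add_subset_add subset_orth_orth subset_orth_orth
  | bangR Γ Δ A _ ih =>
    simp only [Valid, Multiset.map_cons, Multiset.sum_cons, Multiset.map_map,
      Function.comp_def, interp, orth_orth_orth] at ih ⊢
    rw [add_left_comm] at ih ⊢
    exact promotion _ _ _ _ (subset_of_orth_add (orth_orth_interp A) ih)
  | whynotL Γ Δ A _ ih =>
    simp only [Valid, Multiset.map_cons, Multiset.sum_cons, Multiset.map_map,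
      Function.comp_def, interp] at ih ⊢
    rw [add_assoc] at ih ⊢
    exact promotion _ _ _ _ (subset_orth_iff.2 ih)
  | whynotR Γ Δ A _ ih =>
    simp only [Valid, Multiset.map_cons, Multiset.sum_cons, interp] at ih ⊢
    rw [add_left_comm] at ih ⊢
    exact orth_orth_add ((Set.add_subset_add_right Set.inter_subset_left).trans ih)
  | whynotW Γ Δ A _ ih =>
    simp only [Valid, Multiset.map_cons, Multiset.sum_cons, interp] at ih ⊢
    rw [add_left_comm]
    exact orth_orth_add ((Set.add_subset_add_right Set.inter_subset_right).trans (by simpa using ih))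
  | whynotC Γ Δ A _ ih =>
    simp only [Valid, Multiset.map_cons, Multiset.sum_cons, interp] at ih ⊢
    rw [add_left_comm, add_left_comm (Multiset.sum _), ← add_assoc] at ih
    rw [add_left_comm]
    refine orth_orth_add ((Set.add_subset_add_right
      ((subset_add_self Set.inter_subset_right).trans ?_)).trans ih)
    exact Set.add_subset_add subset_orth_orth subset_orth_orth

end PhaseSemantics

/-! ### From derivations to computations -/

namespace PhaseSemantics

open Pointwise LLFormula

variable {M α : Type} [AddCommMonoid M] {B : Set M} {v : α → M} {C D : LLFormula α} {x y : M}

theorem mem_interp_iff : x ∈ interp B v D ↔ ∀ y ∈ orth B (interp B v D), x + y ∈ B := by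
  conv_lhs => rw [← orth_orth_interp D]
  simp [orth, add_comm]

/-- A fact is determined by the contexts that it sends into the pole, so a phase accepted by at
least the contexts of a member is a member. -/
theorem mem_interp_of_imp (hy : y ∈ interp B v D) (h : ∀ z, y + z ∈ B → x + z ∈ B) :
    x ∈ interp B v D :=
  mem_interp_iff.2 fun z hz => h z (hz y hy)

theorem mem_interp_tensor (hx : x ∈ interp B v C) (hy : y ∈ interp B v D) :
    x + y ∈ interp B v (tensor C D) :=
  subset_orth_orth (Set.add_mem_add hx hy)

theorem mem_interp_plus (hx : x ∈ interp B v C) (hy : y ∈ interp B v D) {w : M}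
    (h : ∀ z, x + z ∈ B → y + z ∈ B → w + z ∈ B) : w ∈ interp B v (plus C D) :=
  mem_interp_iff.2 fun z hz => h z (hz x (subset_orth_orth (.inl hx)))
    (hz y (subset_orth_orth (.inr hy)))

theorem mem_interp_atom (a : α) : v a ∈ interp B v (atom a) :=
  subset_orth_orth rfl

/-- An implication contains the unit when it is a mere inclusion of facts; this is how the axioms
under `!` are validated. -/
theorem zero_mem_interp_lolli (h : interp B v C ⊆ interp B v D) :
    0 ∈ interp B v (lolli C D) := by
  have : interp B v C + orth B (interp B v D) ⊆ B := by
    rw [add_comm, ← subset_orth_iff, orth_orth_interp]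
    exact h
  intro x hx
  simpa using this hx

/-- The biorthogonal of a point is the least fact containing it, so inclusions out of an atom are
checked at one phase. -/
theorem interp_atom_subset {a : α} (h : v a ∈ interp B v D) :
    interp B v (atom a) ⊆ interp B v D := by
  rw [← orth_orth_interp D]
  exact orth_anti (orth_anti (Set.singleton_subset_iff.2 h))

theorem interp_tensor_atom_subset {a b : α} (h : v a + v b ∈ interp B v D) :
    interp B v (tensor (atom a) (atom b)) ⊆ interp B v D := by
  rw [← orth_orth_interp D] at h ⊢
  refine orth_anti (subset_orth_iff.2 ?_)
  rw [interp, interp, add_assoc]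
  refine orth_orth_add ?_
  rw [add_left_comm]
  refine orth_orth_add ?_
  rw [add_left_comm, ← add_assoc, Set.singleton_add_singleton, add_comm, ← subset_orth_iff]
  simpa using h

theorem zero_mem_sum_map_bang {s : Multiset (LLFormula α)} (h : ∀ A ∈ s, 0 ∈ interp B v A) :
    0 ∈ ((s.map bang).map (interp B v)).sum := by
  induction s using Multiset.induction_on with
  | empty => simp
  | cons A s ih =>
    simp only [Multiset.map_cons, Multiset.sum_cons]
    refine ⟨0, subset_orth_orth ⟨h A (Multiset.mem_cons_self A s), rfl⟩, 0, ?_, add_zero 0⟩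
    exact ih fun C hC => h C (Multiset.mem_cons_of_mem hC)

end PhaseSemantics

/-! ### The phase space of a machine -/

namespace MinskyEnc

open PhaseSemantics LLFormula Pointwise

variable {n : ℕ}

/-- The phase of a literal: labels and killing literals are recorded in a multiset, counters in a
tuple of numbers. -/
def phase : MinskyLit n → Multiset (ℕ ⊕ Fin n) × (Fin n → ℕ)
  | .r m => (0, Pi.single m 1)
  | .l i => ({.inl i}, 0)
  | .κ m => ({.inr m}, 0)

/-- The configurations from which `M` can halt with empty counters, together with the states in
which the `m`-th killing literal can empty all counters. -/
def pole (M : MinskyMachine n) : Set (Multiset (ℕ ⊕ Fin n) × (Fin n → ℕ)) :=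
  {p | (∃ i, p.1 = {.inl i} ∧ M.CanGo ⟨i, p.2⟩ ⟨0, fun _ => 0⟩) ∨ ∃ m, p.1 = {.inr m} ∧ p.2 m = 0}

variable {M : MinskyMachine n}

theorem cons_eq_singleton_iff {β : Type} {a b : β} {s : Multiset β} :
    a ::ₘ s = {b} ↔ s = 0 ∧ a = b := by
  rw [eq_comm, Multiset.singleton_eq_cons_iff, and_comm, eq_comm (a := b)]

/-- Elements of the pole carry exactly one control token, so a context completing a label may
contain counters only. -/
theorem phase_l_add_mem_pole {i : ℕ} {s : Multiset (ℕ ⊕ Fin n)} {c : Fin n → ℕ} :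
    phase (.l i) + (s, c) ∈ pole M ↔ s = 0 ∧ M.CanGo ⟨i, c⟩ ⟨0, fun _ => 0⟩ := by
  simp only [phase, pole, Prod.mk_add_mk, zero_add, Set.mem_ofPred_eq, Multiset.singleton_add,
    cons_eq_singleton_iff]
  aesop

theorem phase_κ_add_mem_pole {m : Fin n} {s : Multiset (ℕ ⊕ Fin n)} {c : Fin n → ℕ} :
    phase (.κ m) + (s, c) ∈ pole M ↔ s = 0 ∧ c m = 0 := by
  simp only [phase, pole, Prod.mk_add_mk, zero_add, Set.mem_ofPred_eq, Multiset.singleton_add,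
    cons_eq_singleton_iff]
  aesop

theorem phase_r_add (m : Fin n) (s : Multiset (ℕ ⊕ Fin n)) (c : Fin n → ℕ) :
    phase (.r m) + (s, c) = (s, Pi.single m 1 + c) := by
  simp [phase]

theorem canGo_of_step {I : MinskyInstr n} (hI : I ∈ M) {K K' K'' : MinskyConfig n}
    (h : I.Step K K') (h' : M.CanGo K' K'') : M.CanGo K K'' :=
  Relation.ReflTransGen.head ⟨I, hI, h⟩ h'

/-- No instruction that moves carries the label zero. Hence `l 0` accepts only empty counters, which
validates `κ m ⊸ l 0`. -/
theorem eq_of_canGo_of_label_eq_zero {K K' : MinskyConfig n} (h : M.CanGo K K')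
    (h0 : K.label = 0) : K = K' := by
  rcases Relation.ReflTransGen.cases_head h with h | ⟨K'', ⟨I, -, hI⟩, -⟩
  · exact h
  · cases hI <;> exact absurd h0 (PNat.ne_zero _)

theorem update_add_one (c : Fin n → ℕ) (m : Fin n) :
    Function.update c m (c m + 1) = Pi.single m 1 + c := by
  ext x
  by_cases h : x = m
  · subst h; simp [add_comm]
  · simp [h]

theorem update_sub_one (c : Fin n → ℕ) (m : Fin n) :
    Function.update (Pi.single m 1 + c) m ((Pi.single m 1 + c : Fin n → ℕ) m - 1) = c := by
  ext x
  by_cases h : x = m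
  · subst h; simp
  · simp [h]

/-- Prefixing a halting computation with one move of `I` gives a halting computation, so the pole is
closed backwards along `I`. -/
theorem zero_mem_interp_phi {I : MinskyInstr n} (hI : I ∈ M) {A : LLFormula (MinskyLit n)}
    (hA : phi I = some A) : 0 ∈ interp (pole M) phase A := by
  cases I with
  | inc i m j =>
    cases hA
    refine zero_mem_interp_lolli (interp_atom_subset ?_)
    refine mem_interp_of_imp (mem_interp_tensor (mem_interp_atom _) (mem_interp_atom _)) ?_
    rintro ⟨s, c⟩ h
    rw [add_assoc, phase_r_add, phase_l_add_mem_pole] at h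
    rw [phase_l_add_mem_pole]
    refine ⟨h.1, canGo_of_step hI (.inc i m j c) ?_⟩
    rw [update_add_one]
    exact h.2
  | dec i m j =>
    cases hA
    refine zero_mem_interp_lolli (interp_tensor_atom_subset ?_)
    refine mem_interp_of_imp (mem_interp_atom _) ?_
    rintro ⟨s, c⟩ h
    rw [phase_l_add_mem_pole] at h
    rw [add_assoc, phase_r_add, phase_l_add_mem_pole]
    refine ⟨h.1, canGo_of_step hI (.dec i m j _ (by simp)) ?_⟩
    rw [update_sub_one]
    exact h.2
  | ifPos i m j =>
    cases hA
    refine zero_mem_interp_lolli (interp_tensor_atom_subset ?_)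
    refine mem_interp_of_imp (mem_interp_tensor (mem_interp_atom _) (mem_interp_atom _)) ?_
    rintro ⟨s, c⟩ h
    rw [add_assoc, phase_r_add, phase_l_add_mem_pole] at h ⊢
    exact ⟨h.1, canGo_of_step hI (.ifPos i m j _ (by simp)) h.2⟩
  | ifZero i m j =>
    cases hA
    refine zero_mem_interp_lolli (interp_atom_subset ?_)
    -- A context accepting the sum accepts both summands; acceptance of `κ m` is what supplies the
    -- hypothesis `c m = 0` of the zero test.
    refine mem_interp_plus (mem_interp_atom _) (mem_interp_atom _) ?_
    rintro ⟨s, c⟩ h h'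
    rw [phase_l_add_mem_pole] at h ⊢
    rw [phase_κ_add_mem_pole] at h'
    exact ⟨h.1, canGo_of_step hI (.ifZero i m j c h'.2) h.2⟩
  | halt => cases hA

/-- The pole constrains only the `m`-th counter of a `κ m` state, so adding `r i` with `i ≠ m` is
harmless. -/
theorem zero_mem_interp_allKilling {A : LLFormula (MinskyLit n)} (hA : A ∈ allKilling n) :
    0 ∈ interp (pole M) phase A := by
  obtain ⟨m, -, hA⟩ := Multiset.mem_sum.1 hA
  rcases Multiset.mem_cons.1 hA with rfl | hA
  · refine zero_mem_interp_lolli (interp_atom_subset ?_)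
    refine mem_interp_of_imp (mem_interp_atom _) ?_
    rintro ⟨s, c⟩ h
    rw [phase_l_add_mem_pole] at h
    rw [phase_κ_add_mem_pole]
    have := eq_of_canGo_of_label_eq_zero h.2 rfl
    simp only [MinskyConfig.mk.injEq, true_and] at this
    exact ⟨h.1, congrFun this m⟩
  · obtain ⟨i, hi, rfl⟩ := Multiset.mem_map.1 hA
    have hi : i ≠ m := (Finset.univ.nodup.mem_erase_iff.1 hi).1
    refine zero_mem_interp_lolli (interp_tensor_atom_subset ?_)
    refine mem_interp_of_imp (mem_interp_atom _) ?_
    rintro ⟨s, c⟩ h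
    rw [phase_κ_add_mem_pole] at h
    rw [add_assoc, phase_r_add, phase_κ_add_mem_pole]
    simpa [hi.symm] using h

/-- The phase of a list of counter literals. -/
theorem mem_interp_foldl_tensor (L : List (Fin n)) {D : LLFormula (MinskyLit n)}
    {p : Multiset (ℕ ⊕ Fin n) × (Fin n → ℕ)} (hp : p ∈ interp (pole M) phase D) :
    p + (L.map fun m => phase (.r m)).sum ∈
      interp (pole M) phase ((L.map r).foldl tensor D) := by
  induction L generalizing D p with
  | nil => simpa using hp
  | cons m L ih =>
    simpa [add_assoc] using 
      ih (D := tensor D (r m)) (mem_interp_tensor hp (mem_interp_atom (MinskyLit.r m)))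

/-- The counter indices, each repeated as often as the value of the counter. -/
def counterList (k : Fin n → ℕ) : List (Fin n) :=
  (List.finRange n).flatMap fun m => List.replicate (k m) m

theorem counters_eq_map (k : Fin n → ℕ) : counters k = (counterList k).map r := by
  simp [counters, counterList, List.map_flatMap]

theorem count_counterList (k : Fin n → ℕ) (m : Fin n) : (counterList k).count m = k m := by
  rw [counterList, List.count_flatMap]
  have : (List.count m ∘ fun x => List.replicate (k x) x) = fun x => if x = m then k x else 0 := by
    ext x
    simp [List.count_replicate]
  rw [this, ← List.ofFn_eq_map, List.sum_ofFn]
  simp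

theorem sum_map_phase_r (L : List (Fin n)) :
    (L.map fun m => phase (.r m)).sum = (0, fun m => L.count m) := by
  induction L with
  | nil => rfl
  | cons m L ih =>
    rw [List.map_cons, List.sum_cons, ih, phase_r_add]
    congr 1
    ext x
    by_cases h : x = m
    · subst h; simp [add_comm]
    · simp [h, Ne.symm h]

theorem canGo_of_derivable {i : ℕ} {k : Fin n → ℕ}
    (h : LLDerivable (config i k ::ₘ ((Phi M).map bang + (allKilling n).map bang)) {l 0}) :
    M.CanGo ⟨i, k⟩ ⟨0, fun _ => 0⟩ := by
  have hv := sound h (pole M) phase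
  have hc : phase (.l i) + (0, k) ∈ interp (pole M) phase (config i k) := by
    have := mem_interp_foldl_tensor (M := M) (counterList k) (mem_interp_atom (.l i))
    rw [sum_map_phase_r, funext (count_counterList k), ← counters_eq_map] at this
    exact this
  have hb : 0 ∈ (((Phi M).map bang + (allKilling n).map bang).map (interp (pole M) phase)).sum := by
    rw [← Multiset.map_add]
    refine zero_mem_sum_map_bang fun A hA => ?_
    rcases Multiset.mem_add.1 hA with hA | hA
    · obtain ⟨I, hI, hA⟩ := List.mem_filterMap.1 hA
      exact zero_mem_interp_phi hI hA
    · exact zero_mem_interp_allKilling hA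
  have hl : 0 ∈ orth (pole M) (interp (pole M) phase (l 0)) := by
    rw [l, interp, orth_orth_orth]
    rintro _ rfl
    exact phase_l_add_mem_pole.2 ⟨rfl, Relation.ReflTransGen.refl⟩
  rw [Valid, Multiset.map_cons, Multiset.sum_cons, Multiset.map_singleton,
    Multiset.sum_singleton] at hv
  -- The exponentials and the goal `l 0` each contribute the phase `0`, leaving the initial
  -- configuration itself in the pole.
  have := hv (Set.add_mem_add (Set.add_mem_add hc hb) hl)
  rw [add_zero, add_zero, phase_l_add_mem_pole] at this
  exact this.2

end MinskyEnc

/-! ### From computations to derivations -/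

namespace LLDerivable

open LLFormula

variable {α : Type} {Γ Δ X : Multiset (LLFormula α)} {A B : LLFormula α}

theorem of_bang_mem (h : bang A ∈ Γ) (hd : LLDerivable (A ::ₘ Γ) Δ) : LLDerivable Γ Δ := by
  obtain ⟨Γ', rfl⟩ := Multiset.exists_cons_of_mem h
  exact bangC _ _ _ (bangL _ _ _ hd)

theorem add_map_bang (h : LLDerivable Γ Δ) (s : Multiset (LLFormula α)) :
    LLDerivable (Γ + s.map bang) Δ := by
  induction s using Multiset.induction_on with
  | empty => simpa using h
  | cons A s ih =>
    rw [Multiset.map_cons, Multiset.add_cons]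
    exact bangW _ _ _ ih

theorem of_bang_lolli_mem (h : bang (lolli A B) ∈ Γ) (hX : LLDerivable X {A})
    (hB : LLDerivable (B ::ₘ Γ) Δ) : LLDerivable (X + Γ) Δ := by
  refine of_bang_mem (Multiset.mem_add.2 (.inr h)) ?_
  have := lolliL X Γ 0 Δ A B hX hB
  rwa [zero_add] at this

theorem cons_of_bang_lolli_mem (h : bang (lolli A B) ∈ Γ) (hB : LLDerivable (B ::ₘ Γ) Δ) :
    LLDerivable (A ::ₘ Γ) Δ := by
  rw [← Multiset.singleton_add]
  exact of_bang_lolli_mem h (ax A) hB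

theorem cons_cons_of_bang_lolli_mem {C : LLFormula α} (h : bang (lolli (tensor A C) B) ∈ Γ)
    (hB : LLDerivable (B ::ₘ Γ) Δ) : LLDerivable (A ::ₘ C ::ₘ Γ) Δ := by
  rw [← Multiset.singleton_add C, ← Multiset.cons_add]
  exact of_bang_lolli_mem h (tensorR {A} {C} 0 0 A C (ax A) (ax C)) hB

theorem foldl_tensor (L : List (LLFormula α)) :
    LLDerivable (A ::ₘ ((L : Multiset (LLFormula α)) + Γ)) Δ →
      LLDerivable (L.foldl tensor A ::ₘ Γ) Δ := by
  induction L generalizing A with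
  | nil => simp
  | cons B L ih =>
    intro h
    refine ih (tensorL _ _ _ _ ?_)
    rwa [← Multiset.cons_coe, Multiset.cons_add] at h

end LLDerivable

namespace MinskyEnc

open LLFormula LLDerivable

variable {n : ℕ} {M : MinskyMachine n} {Γ : Multiset (LLFormula (MinskyLit n))}

theorem coe_counters_single_add (m : Fin n) (c : Fin n → ℕ) :
    (counters (Pi.single m 1 + c) : Multiset (LLFormula (MinskyLit n))) =
      r m ::ₘ (counters c : Multiset (LLFormula (MinskyLit n))) := by
  rw [counters_eq_map, counters_eq_map, Multiset.cons_coe, ← List.map_cons, Multiset.coe_eq_coe]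
  refine List.Perm.map r (List.perm_iff_count.2 fun x => ?_)
  by_cases h : x = m
  · subst h; simp [count_counterList, add_comm]
  · simp [count_counterList, h, Ne.symm h]

/-- `κ m` consumes the counter literals one at a time and finally becomes `l 0`; the leftover
exponentials are weakened away. -/
theorem derivable_of_killing {m : Fin n} {L : List (Fin n)} (hL : m ∉ L)
    (s : Multiset (LLFormula (MinskyLit n))) :
    LLDerivable (κ m ::ₘ ((L.map r : List (LLFormula (MinskyLit n))) +
      (s + killing m).map bang)) {l 0} := by
  induction L with
  | nil =>
    refine cons_of_bang_lolli_mem (B := l 0) ?_ ?_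
    · refine Multiset.mem_add.2 (.inr (Multiset.mem_map_of_mem _ ?_))
      simp [killing]
    · rw [List.map_nil, Multiset.coe_nil, zero_add]
      exact add_map_bang (ax (l 0)) _
  | cons x L ih =>
    rw [List.mem_cons, not_or] at hL
    rw [List.map_cons, ← Multiset.cons_coe, Multiset.cons_add]
    refine cons_cons_of_bang_lolli_mem (B := κ m) ?_ (ih hL.2)
    refine Multiset.mem_add.2 (.inr (Multiset.mem_map_of_mem _ ?_))
    simp only [killing, Multiset.mem_add, Multiset.mem_cons, Multiset.mem_map]
    exact .inr (.inr ⟨x, Finset.univ.nodup.mem_erase_iff.2 ⟨Ne.symm hL.1, Finset.mem_univ x⟩, rfl⟩)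

theorem derivable_of_step {I : MinskyInstr n} (hI : I ∈ M) {K K' : MinskyConfig n}
    (h : I.Step K K')
    (h' : LLDerivable (l K'.label ::ₘ ((counters K'.counter : Multiset (LLFormula (MinskyLit n))) +
         (Phi M + allKilling n).map bang))
      {l 0}) :
    LLDerivable (l K.label ::ₘ ((counters K.counter : Multiset (LLFormula (MinskyLit n))) +
        (Phi M + allKilling n).map bang)) {l 0} := by
  have mem : ∀ {A} {s : Multiset (LLFormula (MinskyLit n))}, phi I = some A →
      bang A ∈ s + (Phi M + allKilling n).map bang := by
    intro A s hA
    refine Multiset.mem_add.2 (.inr (Multiset.mem_map_of_mem _ (Multiset.mem_add.2 (.inl ?_))))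
    exact List.mem_filterMap.2 ⟨I, hI, hA⟩
  cases h with
  | inc i m j c =>
    refine cons_of_bang_lolli_mem (mem rfl) (tensorL _ _ _ _ ?_)
    rwa [update_add_one, coe_counters_single_add, Multiset.cons_add] at h'
  | dec i m j c hc =>
    obtain ⟨c', rfl⟩ : ∃ c', c = Pi.single m 1 + c' :=
      ⟨Function.update c m (c m - 1), by
        rw [← update_add_one]; simp [Nat.sub_add_cancel (Nat.one_le_iff_ne_zero.2 hc.ne')]⟩
    rw [update_sub_one] at h'
    rw [coe_counters_single_add, Multiset.cons_add]
    exact cons_cons_of_bang_lolli_mem (mem rfl) h'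
  | ifPos i m j c hc =>
    obtain ⟨c', rfl⟩ : ∃ c', c = Pi.single m 1 + c' :=
      ⟨Function.update c m (c m - 1), by
        rw [← update_add_one]; simp [Nat.sub_add_cancel (Nat.one_le_iff_ne_zero.2 hc.ne')]⟩
    rw [coe_counters_single_add, Multiset.cons_add] at h' ⊢
    exact cons_cons_of_bang_lolli_mem (mem rfl)
      (tensorL _ _ _ _ h')
  | ifZero i m j c hc =>
    -- The `l j` branch is the rest of the computation; the `κ m` branch verifies that counter `m`
    -- is empty.
    refine cons_of_bang_lolli_mem (mem rfl) (plusL _ _ _ _ h' ?_)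
    obtain ⟨s, hs⟩ : ∃ s, allKilling n = s + killing m :=
      ⟨_, (Finset.sum_erase_add _ _ (Finset.mem_univ m)).symm⟩
    rw [hs, ← add_assoc, counters_eq_map]
    refine derivable_of_killing ?_ _
    rw [← List.count_eq_zero, count_counterList]
    exact hc

theorem derivable_of_canGo {i : ℕ} {k : Fin n → ℕ} (h : M.CanGo ⟨i, k⟩ ⟨0, fun _ => 0⟩) :
    LLDerivable (config i k ::ₘ ((Phi M).map bang + (allKilling n).map bang)) {l 0} := by
  rw [← Multiset.map_add]
  refine foldl_tensor _ ?_
  suffices ∀ K, M.CanGo K ⟨0, fun _ => 0⟩ →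
      LLDerivable (l K.label ::ₘ ((counters K.counter : Multiset (LLFormula (MinskyLit n))) +
        (Phi M + allKilling n).map bang)) {l 0} from
    this ⟨i, k⟩ h
  intro K hK
  refine Relation.ReflTransGen.head_induction_on hK ?_ ?_
  · have : counters (fun _ : Fin n => 0) = [] := by simp [counters]
    rw [this, Multiset.coe_nil, zero_add]
    exact add_map_bang (ax (l 0)) _
  · rintro K K' ⟨I, hI, hs⟩ - ih
    exact derivable_of_step hI hs ih

/-- Minsky machine computations correspond to derivations of their encodings. -/
theorem canGo_iff_derivable (M : MinskyMachine n) (k : Fin n → ℕ) :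
    M.CanGo ⟨1, k⟩ ⟨0, fun _ => 0⟩ ↔
      LLDerivable (config 1 k ::ₘ ((Phi M).map bang + (allKilling n).map bang)) {l 0} :=
  ⟨derivable_of_canGo, canGo_of_derivable⟩

end MinskyEnc

/-! ### Structured counter programs -/

/-- Structured counter programs over registers indexed by `ι`. In `loop m A P`, the program `A` is
repeated while register `m` is positive, and `P` is the continuation. -/
inductive CounterProg (ι : Type) : Type
  | done : CounterProg ι
  | inc : ι → CounterProg ι → CounterProg ι
  | dec : ι → CounterProg ι → CounterProg ι
  | loop : ι → CounterProg ι → CounterProg ι → CounterProg ι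

namespace CounterProg

variable {ι : Type}

/-- Sequential composition. -/
def append : CounterProg ι → CounterProg ι → CounterProg ι
  | done, Q => Q
  | inc m P, Q => inc m (P.append Q)
  | dec m P, Q => dec m (P.append Q)
  | loop m A P, Q => loop m A (P.append Q)

instance : Append (CounterProg ι) := ⟨append⟩

@[simp] theorem done_append (Q : CounterProg ι) : done ++ Q = Q := rfl

@[simp] theorem inc_append (m : ι) (P Q : CounterProg ι) : inc m P ++ Q = inc m (P ++ Q) := rfl

@[simp] theorem dec_append (m : ι) (P Q : CounterProg ι) : dec m P ++ Q = dec m (P ++ Q) := rfl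

@[simp] theorem loop_append (m : ι) (A P Q : CounterProg ι) :
    loop m A P ++ Q = loop m A (P ++ Q) := rfl

theorem append_done (P : CounterProg ι) : P ++ done = P := by
  induction P <;> simp [*]

theorem append_assoc (P Q R : CounterProg ι) : P ++ Q ++ R = P ++ (Q ++ R) := by
  induction P <;> simp [*]

variable [DecidableEq ι]

open Function in
/-- `Exec P σ τ`: started in the state `σ`, the program `P` terminates in the state `τ`. -/
inductive Exec : CounterProg ι → (ι → ℕ) → (ι → ℕ) → Prop
  | done (σ : ι → ℕ) : Exec done σ σ
  | inc {m : ι} {P : CounterProg ι} {σ τ : ι → ℕ} :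
      Exec P (update σ m (σ m + 1)) τ → Exec (inc m P) σ τ
  | dec {m : ι} {P : CounterProg ι} {σ τ : ι → ℕ} (h : 0 < σ m) :
      Exec P (update σ m (σ m - 1)) τ → Exec (dec m P) σ τ
  | loop_zero {m : ι} {A P : CounterProg ι} {σ τ : ι → ℕ} (h : σ m = 0) :
      Exec P σ τ → Exec (loop m A P) σ τ
  | loop_pos {m : ι} {A P : CounterProg ι} {σ τ : ι → ℕ} (h : 0 < σ m) :
      Exec (A ++ loop m A P) σ τ → Exec (loop m A P) σ τ

namespace Exec

open Function

variable {P Q : CounterProg ι} {σ τ ρ : ι → ℕ}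

theorem append (h : Exec P σ τ) (h' : Exec Q τ ρ) : Exec (P ++ Q) σ ρ := by
  induction h with
  | done => exact h'
  | inc _ ih => exact .inc (ih h')
  | dec h _ ih => exact .dec h (ih h')
  | loop_zero h _ ih => exact .loop_zero h (ih h')
  | @loop_pos m A P σ τ h _ ih =>
    refine .loop_pos h ?_
    have := ih h'
    rwa [append_assoc] at this

/-- Programs are deterministic. This later identifies the final state of an accepting run with the
computed value. -/
theorem unique (h : Exec P σ τ) (h' : Exec P σ ρ) : τ = ρ := by
  induction h with
  | done => cases h'; rfl
  | inc _ ih => cases h' with | inc h' => exact ih h'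
  | dec _ _ ih => cases h' with | dec _ h' => exact ih h'
  | loop_zero h _ ih =>
    cases h' with
    | loop_zero _ h' => exact ih h'
    | loop_pos h0 _ => exact absurd h h0.ne'
  | loop_pos h _ ih =>
    cases h' with
    | loop_zero h0 _ => exact absurd h0 h.ne'
    | loop_pos _ h' => exact ih h'

theorem congr (h : Exec P σ τ) (e : τ = ρ) : Exec P σ ρ := e ▸ h

/-- Execution of a loop whose successive states are known. -/
theorem loop_of_sequence {m : ι} {A : CounterProg ι} (k : ℕ) (s : ℕ → ι → ℕ) (hσ : σ = s 0)
    (h : ∀ j < k, 0 < s j m ∧ Exec A (s j) (s (j + 1))) (h0 : s k m = 0) (hτ : s k = τ) :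
    Exec (CounterProg.loop m A CounterProg.done) σ τ := by
  subst hσ hτ
  induction k generalizing s with
  | zero => exact .loop_zero h0 (.done _)
  | succ k ih =>
    have h1 := h 0 k.succ_pos
    refine .loop_pos h1.1 (h1.2.append ?_)
    exact ih (fun j => s (j + 1)) (fun j hj => h (j + 1) (by lia)) h0

end Exec

/-- Set register `x` to zero. -/
def clear (x : ι) : CounterProg ι := loop x (dec x done) done

/-- Add register `x` to register `y` and set `x` to zero. -/
def move (x y : ι) : CounterProg ι := loop x (dec x (inc y done)) done

/-- Add register `x` to register `y`, with an auxiliary register `t`. -/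
def copy (x y t : ι) : CounterProg ι := loop x (dec x (inc y (inc t done))) done ++ move t x

open Function

theorem exec_clear (x : ι) (σ : ι → ℕ) : Exec (clear x) σ (update σ x 0) := by
  refine Exec.loop_of_sequence (σ x) (fun j => update σ x (σ x - j)) (by simp) ?_
    (by simp) (by simp)
  intro j hj
  refine ⟨by simpa using hj, .dec (by simpa using hj) ((Exec.done _).congr ?_)⟩
  ext z
  simp only [update_apply]
  grind

theorem exec_move {x y : ι} (hxy : x ≠ y) (σ : ι → ℕ) :
    Exec (move x y) σ (update (update σ y (σ y + σ x)) x 0) := by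
  refine Exec.loop_of_sequence (σ x) (fun j => update (update σ y (σ y + j)) x (σ x - j))
    (by simp) ?_ (by simp) (by simp)
  intro j hj
  refine ⟨by simpa using hj, .dec (by simpa using hj) (.inc ((Exec.done _).congr ?_))⟩
  ext z
  simp only [update_apply]
  grind

theorem exec_copy {x y t : ι} (hxy : x ≠ y) (hxt : x ≠ t) (hyt : y ≠ t) (σ : ι → ℕ)
    (ht : σ t = 0) : Exec (copy x y t) σ (update σ y (σ y + σ x)) := by
  refine Exec.append (Exec.loop_of_sequence (σ x)
    (fun j => update (update (update σ y (σ y + j)) x (σ x - j)) t j) ?_ ?_ (by simp [hxt]) rfl)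
    ((exec_move hxt.symm _).congr ?_)
  · ext z
    simp only [update_apply]
    grind
  · intro j hj
    refine ⟨by simpa [hxt] using hj,
      .dec (by simpa [hxt] using hj) (.inc (.inc ((Exec.done _).congr ?_)))⟩
    ext z
    simp only [update_apply]
    grind
  · ext z
    simp only [update_apply]
    grind

/-- Clear the registers `N, …, N + k - 1`. -/
def clearRange (N : ℕ) : ℕ → CounterProg ℕ
  | 0 => done
  | k + 1 => clearRange N k ++ clear (N + k)

theorem exec_clearRange (N k : ℕ) (σ : ℕ → ℕ) :
    Exec (clearRange N k) σ fun x => if N ≤ x ∧ x < N + k then 0 else σ x := by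
  induction k with
  | zero => exact (Exec.done σ).congr (by ext x; simp)
  | succ k ih =>
    refine ih.append ((exec_clear _ _).congr ?_)
    ext x
    simp only [update_apply]
    grind

/-! ### Realizing primitive recursive functions -/

/-- The program `P` adds the value of `f` at the registers `args` to the register `out`, provided
that all registers from `N` on are zero. -/
def Realizes {k : ℕ} (P : CounterProg ℕ) (f : List.Vector ℕ k → ℕ) (args : Fin k → ℕ)
    (out N : ℕ) : Prop :=
  ∀ σ : ℕ → ℕ, (∀ m, N ≤ m → σ m = 0) →
    Exec P σ (update σ out (σ out + f (List.Vector.ofFn fun i => σ (args i))))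

/-- The values are computed one by one into the registers from `N` on. The arguments lie below `N`
and the scratch space starts at `N + k`, so no computation disturbs another. -/
theorem exists_exec_of_realizes {m k : ℕ} {g : Fin k → List.Vector ℕ m → ℕ} {args : Fin m → ℕ}
    {N : ℕ} (hargs : ∀ i, args i < N)
    (hg : ∀ i : Fin k, ∃ P, Realizes P (g i) args (N + i) (N + k)) (j : ℕ) (hj : j ≤ k) :
    ∃ P : CounterProg ℕ, ∀ σ : ℕ → ℕ, (∀ m, N ≤ m → σ m = 0) →
      Exec P σ fun x => if h : N ≤ x ∧ x < N + j then
        g ⟨x - N, by lia⟩ (List.Vector.ofFn fun i => σ (args i)) else σ x := by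
  induction j with
  | zero =>
    exact ⟨done, fun σ _ => (Exec.done σ).congr (by ext x; rw [dif_neg (by lia)])⟩
  | succ j ih =>
    obtain ⟨P, hP⟩ := ih (by lia)
    obtain ⟨Q, hQ⟩ := hg ⟨j, hj⟩
    refine ⟨P ++ Q, fun σ hσ => (hP σ hσ).append ((hQ _ ?_).congr ?_)⟩
    · intro x hx
      rw [dif_neg (by lia), hσ x (by lia)]
    · have h1 : ∀ i, ¬(N ≤ args i ∧ args i < N + j) := fun i => by have := hargs i; lia
      ext x
      simp only [h1, dite_false, update_apply, lt_self_iff_false, and_false]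
      by_cases hx : x = N + j
      · subst hx
        simp [hσ]
      · rw [if_neg hx]
        by_cases h2 : N ≤ x ∧ x < N + j
        · rw [dif_pos h2, dif_pos (by lia)]
        · rw [dif_neg h2, dif_neg (by lia)]

/-- The outer function reads the inner values at `N, …, N + k - 1`; these are cleared at the end so
that the scratch registers are zero again. -/
theorem exists_realizes_comp {m k : ℕ} {f : List.Vector ℕ k → ℕ}
    {g : Fin k → List.Vector ℕ m → ℕ} {args : Fin m → ℕ} {out N : ℕ} (hargs : ∀ i, args i < N)
    (hout : out < N) (hf : ∃ P, Realizes P f (fun i => N + i) out (N + k))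
    (hg : ∀ i : Fin k, ∃ P, Realizes P (g i) args (N + i) (N + k)) :
    ∃ P, Realizes P (fun v => f (List.Vector.ofFn fun i => g i v)) args out N := by
  obtain ⟨P, hP⟩ := exists_exec_of_realizes hargs hg k le_rfl
  obtain ⟨Q, hQ⟩ := hf
  refine ⟨P ++ (Q ++ clearRange N k), fun σ hσ =>
    (hP σ hσ).append ((hQ _ ?_).append ((exec_clearRange N k _).congr ?_))⟩
  · intro x hx
    rw [dif_neg (by lia), hσ x (by lia)]
  · ext x
    simp only [update_apply]
    by_cases hx : N ≤ x ∧ x < N + k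
    · rw [if_pos hx, if_neg (by lia), hσ x hx.1]
    · rw [if_neg hx, dif_neg hx, dif_neg (by lia)]
      simp

theorem exists_realizes_prec {k : ℕ} {f : List.Vector ℕ k → ℕ} {g : List.Vector ℕ (k + 2) → ℕ}
    {args : Fin (k + 1) → ℕ} {out N : ℕ} (hargs : ∀ i, args i < N) (hout : out < N)
    (hf : ∃ P, Realizes P f (fun i => args i.succ) (N + 2) (N + 4))
    (hg : ∃ P, Realizes P g (Fin.cons (N + 1) (Fin.cons (N + 2) fun i => args i.succ))
      (N + 3) (N + 4)) :
    ∃ P, Realizes P (fun v : List.Vector ℕ (k + 1) =>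
      v.head.rec (f v.tail) fun y IH => g (y ::ᵥ IH ::ᵥ v.tail)) args out N := by
  obtain ⟨P, hP⟩ := hf
  obtain ⟨Q, hQ⟩ := hg
  -- Register `N` counts down the remaining iterations, `N + 1` holds the index `y`, `N + 2` the
  -- value of the recursion so far, and `N + 3` receives the next value. The index register doubles
  -- as the auxiliary one for `copy`, since it is still zero then.
  refine ⟨P ++ (copy (args 0) N (N + 1) ++
    (loop N (dec N (Q ++ (clear (N + 2) ++ (move (N + 3) (N + 2) ++ inc (N + 1) done)))) done ++
      (move (N + 2) out ++ clear (N + 1)))), fun σ hσ => ?_⟩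
  have h0 := hargs 0
  set v := List.Vector.ofFn fun i => σ (args (Fin.succ i)) with hv
  let F : ℕ → ℕ := fun j => Nat.rec (f v) (fun y IH => g (y ::ᵥ IH ::ᵥ v)) j
  have hF : ∀ j, F (j + 1) = g (j ::ᵥ F j ::ᵥ v) := fun j => rfl
  refine (hP σ fun m hm => hσ m (by lia)).append ?_
  refine (exec_copy (by lia) (by lia) (by lia) _ ?_).append ?_
  · rw [update_apply, if_neg (by lia), hσ _ (by lia)]
  refine (Exec.loop_of_sequence (σ (args 0)) (fun j => update (update (update σ
    N (σ (args 0) - j)) (N + 1) j) (N + 2) (F j)) ?_ ?_ (by simp) rfl).append ?_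
  · have hσ0 := hσ N le_rfl
    have hσ1 := hσ (N + 1) (by lia)
    have hσ2 := hσ (N + 2) (by lia)
    have hF0 : F 0 = f v := rfl
    ext x
    simp only [update_apply]
    grind
  · intro j hj
    have hsub : 0 < σ (args 0) - j := by lia
    refine ⟨by simpa using hsub, .dec (by simpa using hsub) ?_⟩
    refine (hQ _ ?_).append ((exec_clear _ _).append ((exec_move (by lia) _).append
      (.inc ((Exec.done _).congr ?_))))
    · intro m hm
      have := hσ m (by lia)
      simp only [update_apply]
      grind
    · have hσ3 := hσ (N + 3) (by lia)
      have h2 : ∀ i : Fin k, args i.succ < N := fun i => hargs _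
      have hvec : (List.Vector.ofFn fun i : Fin (k + 2) =>
          (update (update (update (update σ N (σ (args 0) - j)) (N + 1) j) (N + 2) (F j)) N
            (update (update (update σ N (σ (args 0) - j)) (N + 1) j) (N + 2) (F j) N - 1))
          ((Fin.cons (N + 1) (Fin.cons (N + 2) fun i => args i.succ) : Fin (k + 2) → ℕ) i)) =
          j ::ᵥ F j ::ᵥ v := by
        rw [List.Vector.ofFn, List.Vector.ofFn]
        congr 1
        · simp
        · congr 1
          · simp
          · rw [hv]
            congr 1
            ext i
            have := h2 i
            simp only [Fin.cons_succ, update_apply]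
            grind
      rw [hvec, ← hF]
      ext x
      simp only [update_apply]
      grind
  · refine (exec_move (by lia) _).append ((exec_clear _ _).congr ?_)
    have hσ0 := hσ N le_rfl
    have hσ1 := hσ (N + 1) (by lia)
    have hσ2 := hσ (N + 2) (by lia)
    change _ = update σ out (σ out + F (σ (args 0)))
    ext x
    simp only [update_apply]
    grind

/-- Every primitive recursive function is realized by a counter program. -/
theorem exists_realizes {k : ℕ} {f : List.Vector ℕ k → ℕ} (hf : Nat.Primrec' f) :
    ∀ (args : Fin k → ℕ) (out N : ℕ), (∀ i, args i < N) → out < N → (∀ i, args i ≠ out) →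
      ∃ P, Realizes P f args out N := by
  induction hf with
  | zero =>
    exact fun args out N _ _ _ => ⟨done, fun σ _ => (Exec.done σ).congr (by simp)⟩
  | succ =>
    intro args out N hargs hout hne
    have h0 := hargs 0
    refine ⟨copy (args 0) out N ++ inc out done, fun σ hσ =>
      (exec_copy (hne 0) (by lia) (by lia) σ (hσ N le_rfl)).append (.inc ((Exec.done _).congr ?_))⟩
    simp [List.Vector.ofFn, add_assoc]
  | get i =>
    intro args out N hargs hout hne
    have h0 := hargs i
    refine ⟨copy (args i) out N, fun σ hσ =>
      (exec_copy (hne i) (by lia) (by lia) σ (hσ N le_rfl)).congr ?_⟩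
    simp
  | comp g _ _ ihf ihg =>
    intro args out N hargs hout hne
    refine exists_realizes_comp hargs hout (ihf _ _ _ (fun i => by lia) (by lia) fun i => by lia)
      fun i => ihg i _ _ _ (fun a => (hargs a).trans_le (by lia)) (by lia) fun a => ?_
    have := hargs a
    lia
  | prec _ _ ihf ihg =>
    intro args out N hargs hout hne
    have h : ∀ i, args i < N + 2 := fun i => (hargs i).trans_le (by lia)
    refine exists_realizes_prec hargs hout
      (ihf _ _ _ (fun i => (h _).trans_le (by lia)) (by lia) fun i => (h _).ne)
      (ihg _ _ _ ?_ (by lia) ?_)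
    · refine Fin.cases (by simp) (Fin.cases (by simp) fun i => ?_)
      simpa using (h _).trans_le (by lia)
    · refine Fin.cases (by simp) (Fin.cases (by simp) fun i => ?_)
      simpa using ((h i.succ).trans_le (by lia)).ne

end CounterProg

/-! ### Minsky machines for counter programs -/

namespace CounterProg

open Function

/-- The registers of a program are below `N`. -/
def BoundedBy (N : ℕ) : CounterProg ℕ → Prop
  | done => True
  | inc m P => m < N ∧ P.BoundedBy N
  | dec m P => m < N ∧ P.BoundedBy N
  | loop m A P => m < N ∧ A.BoundedBy N ∧ P.BoundedBy N

theorem BoundedBy.mono {N N' : ℕ} (h : N ≤ N') {P : CounterProg ℕ} (hP : P.BoundedBy N) :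
    P.BoundedBy N' := by
  induction P with
  | done => trivial
  | inc m P ih => exact ⟨hP.1.trans_le h, ih hP.2⟩
  | dec m P ih => exact ⟨hP.1.trans_le h, ih hP.2⟩
  | loop m A P ihA ihP => exact ⟨hP.1.trans_le h, ihA hP.2.1, ihP hP.2.2⟩

theorem exists_boundedBy (P : CounterProg ℕ) : ∃ N, P.BoundedBy N := by
  induction P with
  | done => exact ⟨0, trivial⟩
  | inc m P ih | dec m P ih =>
    obtain ⟨N, hN⟩ := ih
    exact ⟨max (m + 1) N, by simp, hN.mono (by simp)⟩
  | loop m A P ihA ihP =>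
    obtain ⟨N, hN⟩ := ihA
    obtain ⟨N', hN'⟩ := ihP
    exact ⟨max (m + 1) (max N N'), by simp, hN.mono (by simp), hN'.mono (by simp)⟩

theorem BoundedBy.append {N : ℕ} {P Q : CounterProg ℕ} (hP : P.BoundedBy N) (hQ : Q.BoundedBy N) :
    (P ++ Q).BoundedBy N := by
  induction P with
  | done => exact hQ
  | inc m P ih | dec m P ih => exact ⟨hP.1, ih hP.2⟩
  | loop m A P _ ihP => exact ⟨hP.1, hP.2.1, ihP hP.2.2⟩

/-- Rename the registers of a program. -/
def map {ι κ : Type} (f : ι → κ) : CounterProg ι → CounterProg κ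
  | done => done
  | inc m P => inc (f m) (P.map f)
  | dec m P => dec (f m) (P.map f)
  | loop m A P => loop (f m) (A.map f) (P.map f)

theorem map_append {ι κ : Type} (f : ι → κ) (P Q : CounterProg ι) :
    (P ++ Q).map f = P.map f ++ Q.map f := by
  induction P <;> simp [map, *]

theorem Exec.map_ofNat {n : ℕ} [NeZero n] {P : CounterProg ℕ} {σ τ : ℕ → ℕ} (h : Exec P σ τ)
    (hP : P.BoundedBy n) : Exec (P.map (Fin.ofNat n)) (fun i => σ i) fun i => τ i := by
  have val : ∀ {m}, m < n → ((Fin.ofNat n m : Fin n) : ℕ) = m := fun h => Nat.mod_eq_of_lt h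
  have upd : ∀ {m} (σ : ℕ → ℕ) (v : ℕ), m < n → (fun i : Fin n => update σ m v i) =
      update (fun i : Fin n => σ i) (Fin.ofNat n m) v := by
    intro m σ v hm
    ext i
    simp only [update_apply, Fin.ext_iff, val hm]
  induction h with
  | done => exact .done _
  | inc _ ih =>
    have := ih hP.2
    rw [upd _ _ hP.1] at this
    exact .inc (by rwa [val hP.1])
  | dec h _ ih =>
    have := ih hP.2
    rw [upd _ _ hP.1] at this
    exact .dec (by rwa [val hP.1]) (by rwa [val hP.1])
  | loop_zero h _ ih => exact .loop_zero (by rwa [val hP.1]) (ih hP.2.2)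
  | loop_pos h _ ih =>
    have := ih (hP.2.1.append hP)
    rw [map_append] at this
    exact .loop_pos (by rwa [val hP.1]) this

/-! ### Compilation: remaining programs as labels -/

variable {n : ℕ}

/-- An injective numbering of programs in which only `done` is less than `2`. -/
def toNat : CounterProg (Fin n) → ℕ
  | done => 0
  | inc m P => 3 * Nat.pair m P.toNat + 2
  | dec m P => 3 * Nat.pair m P.toNat + 3
  | loop m A P => 3 * Nat.pair m (Nat.pair A.toNat P.toNat) + 4

theorem toNat_injective : Injective (toNat (n := n)) := by
  intro P
  induction P with
  | done => intro Q h; cases Q <;> simp [toNat] at h ⊢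
  | inc m P ih | dec m P ih =>
    intro Q h
    cases Q <;> simp only [toNat] at h <;> try lia
    have h := Nat.pair_eq_pair.1 (Nat.eq_of_mul_eq_mul_left three_pos (Nat.add_right_cancel h))
    rw [Fin.ext h.1, ih h.2]
  | loop m A P ihA ihP =>
    intro Q h
    cases Q <;> simp only [toNat] at h <;> try lia
    have h := Nat.pair_eq_pair.1 (Nat.eq_of_mul_eq_mul_left three_pos (Nat.add_right_cancel h))
    have h' := Nat.pair_eq_pair.1 h.2
    rw [Fin.ext h.1, ihA h'.1, ihP h'.2]

/-- Keeps label `1`, the initial one, free for the guessing loop. -/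
theorem toNat_ne_one (P : CounterProg (Fin n)) : P.toNat ≠ 1 := by
  cases P <;> simp [toNat]

/-- The label of a program other than `done`. -/
def label (P : CounterProg (Fin n)) : ℕ+ := P.toNat.toPNat'

theorem coe_label {P : CounterProg (Fin n)} (h : P ≠ done) : (P.label : ℕ) = P.toNat := by
  have : P.toNat ≠ 0 := fun h0 => h (toNat_injective h0)
  rw [label, Nat.toPNat'_coe, if_pos (Nat.pos_of_ne_zero this)]

/-- The instructions executing the first step of a program. -/
def instrs : CounterProg (Fin n) → List (MinskyInstr n)
  | done => []
  | inc m P => [.inc (label (inc m P)) m P.toNat]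
  | dec m P => [.dec (label (dec m P)) m P.toNat]
  | loop m A P => [.ifZero (label (loop m A P)) m P.toNat,
      .ifPos (label (loop m A P)) m (A ++ loop m A P).toNat]

theorem exec_of_step {R : CounterProg (Fin n)} {I : MinskyInstr n} (hI : I ∈ R.instrs)
    {K K' : MinskyConfig n} (h : I.Step K K') : ∃ R' : CounterProg (Fin n),
      K.label = R.toNat ∧ K'.label = R'.toNat ∧
        ∀ τ, Exec R' K'.counter τ → Exec R K.counter τ := by
  cases R with
  | done => cases hI
  | inc m P =>
    obtain rfl := List.mem_singleton.1 hI
    cases h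
    exact ⟨P, coe_label (by simp), rfl, fun τ => .inc⟩
  | dec m P =>
    obtain rfl := List.mem_singleton.1 hI
    cases h with
    | dec _ _ _ _ hc => exact ⟨P, coe_label (by simp), rfl, fun τ => .dec hc⟩
  | loop m A P =>
    rcases List.mem_pair.1 hI with rfl | rfl
    · cases h with
      | ifZero _ _ _ _ hc => exact ⟨P, coe_label (by simp), rfl, fun τ => .loop_zero hc⟩
    · cases h with
      | ifPos _ _ _ _ hc => exact ⟨_, coe_label (by simp), rfl, fun τ => .loop_pos hc⟩

/-- The programs that remain to be executed during an execution of `P ++ K`, up to `K`. -/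
def remainders : CounterProg (Fin n) → CounterProg (Fin n) → List (CounterProg (Fin n))
  | done, _ => []
  | inc m P, K => (inc m P ++ K) :: P.remainders K
  | dec m P, K => (dec m P ++ K) :: P.remainders K
  | loop m A P, K => (loop m A P ++ K) :: (A.remainders (loop m A P ++ K) ++ P.remainders K)

/-- The programs that may remain after the first step of a program. -/
def successors : CounterProg (Fin n) → List (CounterProg (Fin n))
  | done => []
  | inc _ P => [P]
  | dec _ P => [P]
  | loop m A P => [P, A ++ loop m A P]

theorem append_mem_remainders (P K : CounterProg (Fin n)) :
    P ++ K ∈ P.remainders K ∨ P ++ K = K := by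
  cases P <;> simp [remainders]

/-- A loop body is followed by the loop itself, so its remainders are taken with the loop as
continuation. The finite list is then closed under steps, and finitely many instructions suffice. -/
theorem successors_mem_remainders {P K R R' : CounterProg (Fin n)} (hR : R ∈ P.remainders K)
    (hR' : R' ∈ R.successors) : R' ∈ P.remainders K ∨ R' = K := by
  induction P generalizing K with
  | done => cases hR
  | inc m P ih | dec m P ih =>
    rcases List.mem_cons.1 hR with rfl | hR
    · obtain rfl := List.mem_singleton.1 hR'
      exact (append_mem_remainders P K).imp_left (List.mem_cons_of_mem _)
    · exact (ih hR).imp_left (List.mem_cons_of_mem _)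
  | loop m A P ihA ihP =>
    simp only [remainders, List.mem_cons, List.mem_append] at hR ⊢
    rcases hR with rfl | hR | hR
    · rcases List.mem_pair.1 hR' with rfl | rfl
      · have := append_mem_remainders P K
        tauto
      · have := append_mem_remainders A (loop m A P ++ K)
        tauto
    · have := ihA hR
      tauto
    · have := ihP hR
      tauto

/-- The machine that adds an arbitrary number to the counter `g` and then executes `P`. -/
def guessMachine (g : Fin n) (P : CounterProg (Fin n)) : MinskyMachine n :=
  [.inc 1 g 1, .ifZero 1 g P.toNat, .ifPos 1 g P.toNat] ++ (P.remainders done).flatMap instrs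

theorem canGo_of_exec {M : MinskyMachine n} {P R : CounterProg (Fin n)} {σ τ : Fin n → ℕ}
    (hM : ∀ R ∈ P.remainders done, ∀ I ∈ R.instrs, I ∈ M) (h : Exec R σ τ)
    (hR : R ∈ P.remainders done ∨ R = done) : M.CanGo ⟨R.toNat, σ⟩ ⟨0, τ⟩ := by
  have next : ∀ {R R' : CounterProg (Fin n)}, R ≠ done → R ∈ P.remainders done ∨ R = done →
      R' ∈ R.successors → R ∈ P.remainders done ∧ (R' ∈ P.remainders done ∨ R' = done) := by
    intro R R' h0 h h'
    have := h.resolve_right h0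
    exact ⟨this, successors_mem_remainders this h'⟩
  induction h with
  | done => exact Relation.ReflTransGen.refl
  | @inc m Q σ τ _ ih =>
    obtain ⟨h1, h2⟩ := next (by simp) hR (List.mem_singleton_self Q)
    rw [← coe_label (by simp)]
    exact MinskyEnc.canGo_of_step (hM _ h1 _ (List.mem_singleton_self _)) (.inc _ _ _ _) (ih h2)
  | @dec m Q σ τ h _ ih =>
    obtain ⟨h1, h2⟩ := next (by simp) hR (List.mem_singleton_self Q)
    rw [← coe_label (by simp)]
    exact MinskyEnc.canGo_of_step (hM _ h1 _ (List.mem_singleton_self _)) (.dec _ _ _ _ h) (ih h2)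
  | loop_zero h _ ih =>
    obtain ⟨h1, h2⟩ := next (by simp) hR (List.mem_pair.2 (.inl rfl))
    rw [← coe_label (by simp)]
    exact MinskyEnc.canGo_of_step (hM _ h1 _ (List.mem_pair.2 (.inl rfl))) (.ifZero _ _ _ _ h)
      (ih h2)
  | loop_pos h _ ih =>
    obtain ⟨h1, h2⟩ := next (by simp) hR (List.mem_pair.2 (.inr rfl))
    rw [← coe_label (by simp)]
    exact MinskyEnc.canGo_of_step (hM _ h1 _ (List.mem_pair.2 (.inr rfl))) (.ifPos _ _ _ _ h)
      (ih h2)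

theorem guessMachine_canGo_of_exec {g : Fin n} {P : CounterProg (Fin n)} {τ : Fin n → ℕ} (v : ℕ) :
    ∀ {σ : Fin n → ℕ}, Exec P (update σ g (σ g + v)) τ →
      (guessMachine g P).CanGo ⟨1, σ⟩ ⟨0, τ⟩ := by
  induction v with
  | zero =>
    intro σ h
    rw [add_zero, update_eq_self] at h
    have hgo : (guessMachine g P).CanGo ⟨P.toNat, σ⟩ ⟨0, τ⟩ := by
      refine canGo_of_exec (P := P) (fun R hR I hI => ?_) h ?_
      · exact List.mem_append_right _ (List.mem_flatMap.2 ⟨R, hR, hI⟩)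
      · simpa only [append_done] using append_mem_remainders P done
    -- There is no unconditional jump: the two tests with the same target together act as one.
    rcases Nat.eq_zero_or_pos (σ g) with h0 | h0
    · exact MinskyEnc.canGo_of_step (I := .ifZero 1 g P.toNat) (by simp [guessMachine])
        (.ifZero 1 g _ σ h0) hgo
    · exact MinskyEnc.canGo_of_step (I := .ifPos 1 g P.toNat) (by simp [guessMachine])
        (.ifPos 1 g _ σ h0) hgo
  | succ v ih =>
    intro σ h
    refine MinskyEnc.canGo_of_step (I := .inc 1 g 1) (by simp [guessMachine]) (.inc 1 g 1 σ) (ih ?_)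
    simpa [add_assoc, add_comm 1] using h

/-- Both claims go through one backward induction, because leaving label `1` passes from the
guessing phase to the execution phase. -/
theorem exec_of_guessMachine_canGo {g : Fin n} {P : CounterProg (Fin n)} {τ : Fin n → ℕ}
    {K : MinskyConfig n} (h : (guessMachine g P).CanGo K ⟨0, τ⟩) :
    (∀ R : CounterProg (Fin n), K.label = R.toNat → Exec R K.counter τ) ∧
      (K.label = 1 → ∃ v, Exec P (update K.counter g (K.counter g + v)) τ) := by
  refine Relation.ReflTransGen.head_induction_on h ?_ ?_
  · refine ⟨fun R hR => ?_, fun h => absurd h zero_ne_one⟩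
    obtain rfl : done = R := toNat_injective hR
    exact .done τ
  · rintro K K' ⟨I, hI, hs⟩ - ih
    rcases List.mem_append.1 hI with hI | hI
    · have h1 : K.label = 1 ∧ ∃ v, Exec P (update K.counter g (K.counter g + v)) τ := by
        simp only [List.mem_cons, List.not_mem_nil, or_false] at hI
        rcases hI with rfl | rfl | rfl <;> cases hs
        · refine ⟨rfl, ?_⟩
          obtain ⟨v, hv⟩ := ih.2 rfl
          exact ⟨1 + v, by simpa [add_assoc] using hv⟩
        · exact ⟨rfl, 0, by simpa using ih.1 P rfl⟩
        · exact ⟨rfl, 0, by simpa using ih.1 P rfl⟩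
      exact ⟨fun R hR => absurd (hR.symm.trans h1.1) R.toNat_ne_one, fun _ => h1.2⟩
    · obtain ⟨R, -, hI⟩ := List.mem_flatMap.1 hI
      obtain ⟨R', h1, h2, h3⟩ := exec_of_step hI hs
      refine ⟨fun S hS => ?_, fun h => absurd (h1.symm.trans h) R.toNat_ne_one⟩
      obtain rfl : R = S := toNat_injective (h1.symm.trans hS)
      exact h3 τ (ih.1 R' h2)

end CounterProg

open CounterProg Function in
/-- Every recursively enumerable set, presented as the projection of the zero set of a primitive
recursive function, is accepted by a Minsky machine. -/
theorem exists_minskyMachine {p : ℕ → ℕ → ℕ} (hp : Primrec₂ p) :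
    ∃ (n : ℕ) (M : MinskyMachine (n + 1)), ∀ k,
      M.CanGo ⟨1, Pi.single 0 k⟩ ⟨0, fun _ => 0⟩ ↔ ∃ v, p k v = 0 := by
  -- Registers `0` and `1` hold the input and the guess, `2` the result, and scratch space starts at
  -- `3`. Clearing `0` and `1` afterwards leaves the result as the only possibly nonzero register.
  obtain ⟨P, hP⟩ := exists_realizes (Nat.Primrec'.prim_iff₂.2 hp) (fun i => (i : ℕ)) 2 3
    (fun i => by lia) (by lia) (fun i => by lia)
  let Q := P ++ (clear 0 ++ clear 1)
  have hQ : ∀ k v, Exec Q (update (Pi.single 0 k) 1 v) (Pi.single 2 (p k v)) := by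
    intro k v
    refine (hP _ fun m hm => ?_).append ((exec_clear _ _).append ((exec_clear _ _).congr ?_))
    · rw [update_of_ne (by lia), Pi.single_eq_of_ne (by lia)]
    · ext x
      simp [List.Vector.ofFn, update_apply, Pi.single_apply]
      grind
  obtain ⟨N, hN⟩ := exists_boundedBy Q
  -- At least three counters, so that `0`, `1` and `2` stay distinct in `Fin`.
  have hN' : Q.BoundedBy (N + 2 + 1) := hN.mono (by lia)
  have hfin : ∀ k v, Exec (Q.map (Fin.ofNat (N + 2 + 1)))
      (update (Pi.single 0 k) 1 v) (Pi.single 2 (p k v)) := by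
    intro k v
    have := (hQ k v).map_ofNat hN'
    have e : ∀ {m : ℕ} (i : Fin (N + 2 + 1)), m < 3 → ((i : ℕ) = m ↔ i = Fin.ofNat _ m) := by
      intro m i hm
      rw [Fin.ext_iff]
      change _ ↔ (i : ℕ) = m % _
      rw [Nat.mod_eq_of_lt (by lia)]
    convert this using 1
    · ext i
      simp only [update_apply, Pi.single_apply, e i (show 0 < 3 by lia), e i (show 1 < 3 by lia)]
      rfl
    · ext i
      simp only [Pi.single_apply, e i (show 2 < 3 by lia)]
      rfl
  refine ⟨N + 2, guessMachine 1 (Q.map (Fin.ofNat _)), fun k => ⟨fun h => ?_, ?_⟩⟩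
  · obtain ⟨v, hv⟩ := (exec_of_guessMachine_canGo h).2 rfl
    change Exec _ (update (Pi.single 0 k) 1 ((Pi.single 0 k : Fin (N + 2 + 1) → ℕ) 1 + v)) _ at hv
    rw [Pi.single_eq_of_ne (by simp), zero_add] at hv
    refine ⟨v, ?_⟩
    simpa using congrFun ((hfin k v).unique hv) 2
  · rintro ⟨v, hv⟩
    have := hfin k v
    rw [hv, Pi.single_zero] at this
    refine guessMachine_canGo_of_exec v ?_
    rwa [Pi.single_eq_of_ne (by simp), zero_add]

/-! ### Undecidability -/

namespace LLFormula

/-- Rename the literals of a formula. -/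
def map {α β : Type} (f : α → β) : LLFormula α → LLFormula β
  | atom a => atom (f a)
  | neg A => neg (A.map f)
  | one => one
  | bot => bot
  | top => top
  | zero => zero
  | tensor A B => tensor (A.map f) (B.map f)
  | par A B => par (A.map f) (B.map f)
  | lolli A B => lolli (A.map f) (B.map f)
  | amp A B => amp (A.map f) (B.map f)
  | plus A B => plus (A.map f) (B.map f)
  | bang A => bang (A.map f)
  | whynot A => whynot (A.map f)

theorem map_map_of_leftInverse {α β : Type} {f : α → β} {g : β → α}
    (h : Function.LeftInverse g f) (A : LLFormula α) : (A.map f).map g = A := by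
  induction A <;> simp [map, h _, *]

end LLFormula

namespace LLDerivable

theorem map {α β : Type} (f : α → β) {Γ Δ : Multiset (LLFormula α)} (h : LLDerivable Γ Δ) :
    LLDerivable (Γ.map (LLFormula.map f)) (Δ.map (LLFormula.map f)) := by
  induction h with
  | bangR Γ Δ A _ ih =>
    simp only [Multiset.map_cons, Multiset.map_map, Function.comp_def, LLFormula.map] at ih ⊢
    simpa only [Multiset.map_map, Function.comp_def] using
      bangR (Γ.map (LLFormula.map f)) (Δ.map (LLFormula.map f)) (A.map f)
        (by simpa only [Multiset.map_map, Function.comp_def] using ih)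
  | whynotL Γ Δ A _ ih =>
    simp only [Multiset.map_cons, Multiset.map_map, Function.comp_def, LLFormula.map] at ih ⊢
    simpa only [Multiset.map_map, Function.comp_def] using
      whynotL (Γ.map (LLFormula.map f)) (Δ.map (LLFormula.map f)) (A.map f)
        (by simpa only [Multiset.map_map, Function.comp_def] using ih)
  | _ =>
    simp only [Multiset.map_cons, Multiset.map_add, Multiset.map_singleton, Multiset.map_zero,
      LLFormula.map] at *
    first
    | exact ax _
    | exact cut _ _ _ _ _ ‹_› ‹_›
    | exact negL _ _ _ ‹_›
    | exact negR _ _ _ ‹_›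
    | exact oneL _ _ ‹_›
    | exact oneR
    | exact botL
    | exact botR _ _ ‹_›
    | exact topR _ _
    | exact zeroL _ _
    | exact tensorL _ _ _ _ ‹_›
    | exact tensorR _ _ _ _ _ _ ‹_› ‹_›
    | exact parL _ _ _ _ _ _ ‹_› ‹_›
    | exact parR _ _ _ _ ‹_›
    | exact lolliL _ _ _ _ _ _ ‹_› ‹_›
    | exact lolliR _ _ _ _ ‹_›
    | exact ampL₁ _ _ _ _ ‹_›
    | exact ampL₂ _ _ _ _ ‹_›
    | exact ampR _ _ _ _ ‹_› ‹_›
    | exact plusL _ _ _ _ ‹_› ‹_›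
    | exact plusR₁ _ _ _ _ ‹_›
    | exact plusR₂ _ _ _ _ ‹_›
    | exact bangL _ _ _ ‹_›
    | exact bangW _ _ _ ‹_›
    | exact bangC _ _ _ ‹_›
    | exact whynotR _ _ _ ‹_›
    | exact whynotW _ _ _ ‹_›
    | exact whynotC _ _ _ ‹_›

/-- A derivation over the larger alphabet, whatever foreign literals its cuts involve, is renamed
back along a left inverse of `f`. -/
theorem map_iff {α β : Type} [Nonempty α] {f : α → β} (hf : Function.Injective f)
    {Γ Δ : Multiset (LLFormula α)} :
    LLDerivable (Γ.map (LLFormula.map f)) (Δ.map (LLFormula.map f)) ↔ LLDerivable Γ Δ := by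
  refine ⟨fun h => ?_, LLDerivable.map f⟩
  have := h.map (Function.invFun f)
  simpa [Multiset.map_map, Function.comp_def,
    LLFormula.map_map_of_leftInverse (Function.leftInverse_invFun hf)] using this

end LLDerivable

namespace MinskyEnc

open LLFormula

variable {n : ℕ}

/-- An injective numbering of the literals of the encoding. -/
def litToNat : MinskyLit n → ℕ
  | .r m => 3 * m
  | .l i => 3 * i + 1
  | .κ m => 3 * m + 2

theorem litToNat_injective : Function.Injective (litToNat (n := n)) := by
  intro a b h
  cases a <;> cases b <;> simp only [litToNat] at h <;> first | lia | (congr 1; lia)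

theorem counters_single_zero (k : ℕ) :
    counters (Pi.single 0 k : Fin (n + 1) → ℕ) = List.replicate k (r 0) := by
  rw [counters, List.finRange_succ, List.flatMap_cons, List.flatMap_map]
  simp

/-- The Gödel number of the encoding of an initial configuration with at most one nonzero
counter. -/
theorem code_map_config (k : ℕ) :
    ((config 1 (Pi.single 0 k : Fin (n + 1) → ℕ)).map litToNat).code =
      (fun x => Nat.pair 6 (Nat.pair x (Nat.pair 0 0)))^[k] (Nat.pair 0 4) := by
  rw [config, counters_single_zero]
  induction k with
  | zero => rfl
  | succ k ih =>
    rw [List.replicate_succ', List.foldl_append, Function.iterate_succ_apply', ← ih]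
    rfl

end MinskyEnc

open Nat.Partrec (Code) in
/-- The halting set is the projection of the zero set of a primitive recursive function. -/
theorem exists_primrec_eval_dom_iff :
    ∃ p : ℕ → ℕ → ℕ, Primrec₂ p ∧ ∀ c : Code, (c.eval 0).Dom ↔ ∃ v, p (Encodable.encode c) v = 0 := by
  -- Here `v` is the bound of the step-bounded evaluator; the value is zero exactly when evaluation
  -- succeeds within it.
  refine ⟨fun k v => bif (Code.evaln v (Denumerable.ofNat Code k) 0).isSome then 0 else 1, ?_,
    fun c => ?_⟩
  · refine Primrec.cond (Primrec.option_isSome.comp (Code.primrec_evaln.comp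
      (Primrec.pair (Primrec.pair Primrec.snd ((Primrec.ofNat Code).comp Primrec.fst))
        (Primrec.const 0)))) (Primrec.const 0) (Primrec.const 1)
  · rw [Part.dom_iff_mem]
    have h : ∀ b : Bool, (bif b then 0 else 1) = 0 ↔ b = true := by decide
    simp only [Code.evaln_complete, Denumerable.ofNat_encode, h, Option.isSome_iff_exists]
    exact exists_comm

open LLFormula MinskyEnc in
/-- Propositional linear logic is undecidable. -/
theorem not_llDecidable : ¬ LLDecidable := by
  rintro ⟨f, hf, hfd⟩
  obtain ⟨p, hp, hpd⟩ := exists_primrec_eval_dom_iff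
  obtain ⟨n, M, hM⟩ := exists_minskyMachine hp
  refine ComputablePred.halting_problem 0 (ComputablePred.computable_iff.2 ?_)
  have : Nonempty (MinskyLit (n + 1)) := ⟨.l 0⟩
  -- The exponential part does not depend on the input, so any fixed list representing it enters the
  -- reduction as a constant.
  obtain ⟨L, hL⟩ := Quot.exists_rep (((Phi M).map bang + (allKilling (n + 1)).map bang).map
    (LLFormula.map litToNat))
  -- `Nat.pair 0 4` codes the renamed `l 1`, and each iteration adjoins a tensor factor `r 0`, coded
  -- by `Nat.pair 0 0`.
  have hcomp : Computable fun k : ℕ =>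
      ((fun x => Nat.pair 6 (Nat.pair x (Nat.pair 0 0)))^[k] (Nat.pair 0 4) :: L.map code,
        [((l 0 : LLFormula (MinskyLit (n + 1))).map litToNat).code]) := by
    refine Primrec.to_comp (Primrec.pair (Primrec.list_cons.comp ?_ (Primrec.const _))
      (Primrec.const _))
    exact Primrec.nat_iterate Primrec.id (Primrec.const _)
      (Primrec₂.natPair.comp (Primrec.const 6)
        (Primrec₂.natPair.comp Primrec.snd (Primrec.const _)))
  refine ⟨_, hf.comp (hcomp.comp Computable.encode), funext fun c => propext ?_⟩
  rw [hpd, ← hM, canGo_iff_derivable, ← LLDerivable.map_iff litToNat_injective,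
    Multiset.map_cons, ← hL, Multiset.map_singleton]
  have := hfd ((config 1 (Pi.single 0 (Encodable.encode c) : Fin (n + 1) → ℕ)).map litToNat :: L)
    [(l 0 : LLFormula (MinskyLit (n + 1))).map litToNat]
  rw [List.map_cons, code_map_config] at this
  exact this.symm

theorem theorem5 :
    (∀ (n : ℕ) (M : MinskyMachine n) (k : Fin n → ℕ),
      M.CanGo ⟨1, k⟩ ⟨0, fun _ => 0⟩ ↔
        LLDerivable
          (MinskyEnc.config 1 k ::ₘ
            ((MinskyEnc.Phi M).map LLFormula.bang + (MinskyEnc.allKilling n).map LLFormula.bang))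
          {MinskyEnc.l 0}) ∧
    ¬ LLDecidable :=
  ⟨fun _ M k => MinskyEnc.canGo_iff_derivable M k, not_llDecidable⟩
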